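/- **Definitions.** Let $D$ be a compact connected surface with boundary (orientable or not). Points, edges, etc. lying in $\partial D$ are called *real*, the others *inner*. A *trichotomic graph* on $D$ is a finite embedded oriented graph $\Gamma\subset D$ whose edges are of three kinds (solid, bold, dotted) and whose vertices are of four kinds ($\bullet$, $\circ$, $\times$, called *essential*, and *monochrome*), such that: $\partial D$ is a union of edges and vertices of $\Gamma$; essential vertices have valency at least $2$, monochrome ones at least $3$; the orientations of the edges form an orientation of the boundary of the cut surface $D_\Gamma$ which extends to an orientation of $D_\Gamma$; all edges at a monochrome vertex are of the same kind; the edges at a $\times$-vertex are incoming dotted or outgoing solid, those at a $\bullet$-vertex incoming solid or outgoing bold, those at a $\circ$-vertex incoming bold or outgoing dotted; each *region* (component of $D_\Gamma$) with exactly three essential vertices in its boundary is a disk. The *full valency* of a vertex is its valency if it is inner and $2\cdot\text{valency}-2$ if it is real. A *dessin* is a trichotomic graph on a surface with $\partial D\ne\varnothing$ in which every $\times$-, $\circ$-, $\bullet$-vertex has full valency $2$, $4$, $6$, respectively, all monochrome vertices are real and have valency $3$, and there is no oriented cycle with all vertices monochrome. It is *unramified* if all its $\times$-vertices are real. It is *of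 type I* if it is equipped with a labelling of its regions by $1,2,3$ such that: the region adjacent to a real solid (bold) edge is not labelled $1$ (respectively, $3$); the two regions adjacent to an inner solid edge are both labelled $1$ or have distinct labels $2$ and $3$; those adjacent to an inner bold edge are both labelled $3$ or have distinct labels $1$ and $2$; those adjacent to an inner dotted edge have the same label. The *type* of a real edge is the label of the adjacent region; the type of an inner dotted edge is the common label of the two adjacent regions. A *real component* is the collection of vertices and edges in a component of $\partial D$; it is *hyperbolic* if all its edges are dotted. A *segment* is a union of closures of real edges of the same kind that is homeomorphic to a closed interval. A dotted (bold) segment is *maximal* if it is bounded by two $\times$- (respectively, $\bullet$-) vertices. A *pillar* is a hyperbolic component or a maximal dotted or bold segment. An *oval* (*zigzag*) is a maximal dotted segment with an even (odd) number of $\circ$-vertices. A *jump* is a pillar formed by a $\circ$-vertex and a pair of real bold segments connecting it to two $\bullet$-vertices, with no other essential vertices. A pillar *has type* $t$ if all its edges are of type $t$. **Theorem.** Let $\Gamma$ be an unramified dessin of type I. Then: 1. The pillars of $\Gamma$ are exactly the ovals, zigzags, jumps, and hyperbolic components. 2. Each pillar has a well-defined type, which is $2$ or $3$; all jumps are of type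 $2$ and all zigzags are of type $3$. Each inner dotted edge is of type $2$ or $3$, and any inner dotted edge attached to a pillar is of the same type as that pillar. 3. Pillars of type $2$ are interconnected by inner dotted edges of type $2$: both end points of each such edge belong to pillars of type $2$, and each pillar of type $2$ has at least one such edge attached to it. These edges, apart from their end points at the $\circ$-vertices of jumps, as well as the pillars of type $2$ other than jumps, are free of $\circ$-vertices. 4. Pillars of type $3$ are interconnected by inner dotted edges of type $3$ or by pairs of such edges attached to an inner $\circ$-vertex each: the terminal point of each inner dotted edge of type $3$ belongs to a pillar of type $3$, and its initial point either belongs to a pillar of type $3$ or is an inner $\circ$-vertex; at each inner $\circ$-vertex there are exactly two dotted edges, both inner, of type $3$, starting at this vertex and ending at pillars of type $3$. 5. (*Parity rule.*) Along each real component of $\Gamma$ the types of the pillars alternate: if $A$ and $B$ are consecutive pillars of a real component, that is, an arc of the component that contains no edge of a pillar leads from $A$ to $B$, then $A$ and $B$ have different types. (If $A$ were the only pillar of a non-hyperbolic real component, it would be consecutive to itself; hence this does not occur.) -/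

import Mathlib

/-- A finite oriented graph `Γ` embedded in a compact connected surface `D` (with boundary,
orientable or not), such that `∂D` is a union of vertices and edges of `Γ` and the orientations of
the edges form the boundary orientation of an orientation of the cut surface `D_Γ`.
It is recorded (up to homeomorphism, without loss) by the cut surface and its gluing pattern.

* `S` is the set of sides of edges, that is, of the edges of the boundary `∂D_Γ` of the cut
  surface. An inner edge of `Γ` has two sides, a real edge (one in `∂D`) has a single side.
  Each side carries the orientation of its edge.
* `twin` exchanges the two sides of each inner edge and fixes the side of each real edge; `D` is
  obtained from `D_Γ` by gluing `s` to `twin s` in an orientation preserving way.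
* `next s` is the side following `s` along the oriented boundary of `D_Γ`, so that
  the boundary circles of `D_Γ` are the cycles of `next`.
* `R` is the set of regions, that is, of the components of `D_Γ`. Each of them is a compact
  connected oriented surface, determined by its boundary circles and its genus. It need not be a
  disk and may have several boundary circles. -/
structure SurfaceGraph (S R : Type*) where
  twin : S → S
  twin_twin : ∀ s, twin (twin s) = s
  next : Equiv.Perm S
  region : S → R
  region_next : ∀ s, region (next s) = region s
  region_surjective : Function.Surjective region
  genus : R → ℕ
  connected : ∀ s t, Relation.EqvGen (fun s t => t = twin s ∨ region s = region t) s t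

namespace SurfaceGraph

variable {S R : Type*}

/-- Each side `s` determines the corner of the cut surface at which `s` ends and `next s` begins.
The gluing identifies the corners at the two heads of the sides of an edge, and the corners at the
two tails of the sides of an edge. -/
def cornerSetoid (G : SurfaceGraph S R) : Setoid S :=
  Relation.EqvGen.setoid (fun s t => t = G.twin s ∨ G.next t = G.twin (G.next s))

/-- The vertices of the graph: classes of corners of the cut surface. -/
abbrev Vertex (G : SurfaceGraph S R) : Type _ := Quotient G.cornerSetoid

/-- The end point of (the edge with) a given side. -/
def head (G : SurfaceGraph S R) (s : S) : G.Vertex := Quotient.mk G.cornerSetoid s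

/-- The starting point of (the edge with) a given side. -/
def tail (G : SurfaceGraph S R) (s : S) : G.Vertex := G.head (G.next.symm s)

/-- The edge with side `s` is incident to the vertex `v`. -/
def Incident (G : SurfaceGraph S R) (s : S) (v : G.Vertex) : Prop :=
  G.head s = v ∨ G.tail s = v

/-- `s` is the side of a real edge, that is, of an edge in the boundary of the surface. A real edge
is identified with its only side. -/
def IsRealEdge (G : SurfaceGraph S R) (s : S) : Prop := G.twin s = s

/-- A vertex is real if it lies in the boundary of the surface, otherwise it is inner. -/
def IsRealVertex (G : SurfaceGraph S R) (v : G.Vertex) : Prop :=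
  ∃ s, G.IsRealEdge s ∧ G.Incident s v

/-- The number of corners of the cut surface at a vertex, that is, the number of sectors into which
the edges cut a neighborhood of the vertex. -/
noncomputable def cornerCount (G : SurfaceGraph S R) (v : G.Vertex) : ℕ :=
  {s | G.head s = v}.ncard

open Classical in
/-- The valency of a vertex. The edge ends and the corners at an inner vertex alternate in a cyclic
order; those at a real vertex alternate in a linear order starting and ending with an edge end. -/
noncomputable def valency (G : SurfaceGraph S R) (v : G.Vertex) : ℕ :=
  if G.IsRealVertex v then G.cornerCount v + 1 else G.cornerCount v

open Classical in
/-- The full valency, that is, the valency in the double of the surface. -/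
noncomputable def fullValency (G : SurfaceGraph S R) (v : G.Vertex) : ℕ :=
  if G.IsRealVertex v then 2 * G.valency v - 2 else G.valency v

/-- A region is a disk if it has genus zero and a single boundary circle. -/
def IsDisk (G : SurfaceGraph S R) (r : R) : Prop :=
  G.genus r = 0 ∧ ∀ s t, G.region s = r → G.region t = r → G.next.SameCycle s t

/-- The set of vertices in the closure of a set of edges. -/
def verts (G : SurfaceGraph S R) (A : Set S) : Set G.Vertex :=
  {v | ∃ s ∈ A, G.Incident s v}

/-- `A` is a set of real edges the union of whose closures is homeomorphic to a closed interval
with end points `u` and `v`: the edges `e 0, …, e n` join consecutive members of a sequence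
of pairwise distinct vertices that leads from `u` to `v`. -/
def IsRealArc (G : SurfaceGraph S R) (A : Set S) (u v : G.Vertex) : Prop :=
  ∃ (n : ℕ) (p : Fin (n + 2) → G.Vertex) (e : Fin (n + 1) → S),
    Function.Injective p ∧ p 0 = u ∧ p (Fin.last (n + 1)) = v ∧
    (∀ i, G.IsRealEdge (e i)) ∧
    (∀ i, (G.tail (e i) = p i.castSucc ∧ G.head (e i) = p i.succ) ∨
          (G.head (e i) = p i.castSucc ∧ G.tail (e i) = p i.succ)) ∧
    A = Set.range e

/-- The set of edges contained in a connected component of the boundary of the surface. -/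
def IsRealComponent (G : SurfaceGraph S R) (K : Set S) : Prop :=
  ∃ s, G.IsRealEdge s ∧
    K = {t | Relation.ReflTransGen
      (fun a b => G.IsRealEdge a ∧ G.IsRealEdge b ∧ ∃ v, G.Incident a v ∧ G.Incident b v) s t}

end SurfaceGraph

/-- The three kinds of edges. -/
inductive EdgeKind
  | solid
  | bold
  | dotted

/-- The four kinds of vertices; those of the first three kinds are called essential. -/
inductive VertexKind
  | black
  | white
  | cross
  | monochrome

/-- A trichotomic graph on a compact connected surface. -/
structure TrichotomicGraph (S R : Type*) extends SurfaceGraph S R where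
  kind : S → EdgeKind
  kind_twin : ∀ s, kind (twin s) = kind s
  vertexKind : toSurfaceGraph.Vertex → VertexKind
  essential_valency : ∀ v, vertexKind v ≠ VertexKind.monochrome → 2 ≤ toSurfaceGraph.valency v
  monochrome_valency : ∀ v, vertexKind v = VertexKind.monochrome → 3 ≤ toSurfaceGraph.valency v
  monochrome_kind : ∀ v, vertexKind v = VertexKind.monochrome →
    ∀ s t, toSurfaceGraph.Incident s v → toSurfaceGraph.Incident t v → kind s = kind t
  cross_in : ∀ s, vertexKind (toSurfaceGraph.head s) = VertexKind.cross →
    kind s = EdgeKind.dotted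
  cross_out : ∀ s, vertexKind (toSurfaceGraph.tail s) = VertexKind.cross →
    kind s = EdgeKind.solid
  black_in : ∀ s, vertexKind (toSurfaceGraph.head s) = VertexKind.black →
    kind s = EdgeKind.solid
  black_out : ∀ s, vertexKind (toSurfaceGraph.tail s) = VertexKind.black →
    kind s = EdgeKind.bold
  white_in : ∀ s, vertexKind (toSurfaceGraph.head s) = VertexKind.white →
    kind s = EdgeKind.bold
  white_out : ∀ s, vertexKind (toSurfaceGraph.tail s) = VertexKind.white →
    kind s = EdgeKind.dotted
  /-- A triangle, that is, a region with exactly three essential vertices in its boundary, is a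
  disk. -/
  triangle_isDisk : ∀ r,
    {s | region s = r ∧
      vertexKind (toSurfaceGraph.head s) ≠ VertexKind.monochrome}.ncard = 3 →
    toSurfaceGraph.IsDisk r

/-- The types used to label regions. -/
inductive RegionType
  | one
  | two
  | three

namespace TrichotomicGraph

variable {S R : Type*}

/-- There is an oriented cycle of the graph all of whose vertices are monochrome. -/
def HasOrientedMonochromeCycle (G : TrichotomicGraph S R) : Prop :=
  ∃ v, Relation.TransGen
    (fun u w => G.vertexKind u = VertexKind.monochrome ∧ G.vertexKind w = VertexKind.monochrome ∧
      ∃ s, G.tail s = u ∧ G.head s = w) v v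

/-- A dessin: a trichotomic graph on a surface with nonempty boundary, with prescribed full
valencies `2`, `4`, `6` of the essential vertices, with all monochrome vertices real and of
valency `3`, and without oriented monochrome cycles. -/
structure IsDessin (G : TrichotomicGraph S R) : Prop where
  boundary_nonempty : ∃ s, G.IsRealEdge s
  cross_fullValency : ∀ v, G.vertexKind v = VertexKind.cross → G.fullValency v = 2
  white_fullValency : ∀ v, G.vertexKind v = VertexKind.white → G.fullValency v = 4
  black_fullValency : ∀ v, G.vertexKind v = VertexKind.black → G.fullValency v = 6
  real_monochrome_valency : ∀ v, G.vertexKind v = VertexKind.monochrome → G.IsRealVertex v →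
    G.valency v = 3
  no_inner_monochrome : ∀ v, G.vertexKind v = VertexKind.monochrome → G.IsRealVertex v
  no_oriented_monochrome_cycle : ¬ G.HasOrientedMonochromeCycle

/-- All cross-vertices are real. -/
def IsUnramified (G : TrichotomicGraph S R) : Prop :=
  ∀ v, G.vertexKind v = VertexKind.cross → G.IsRealVertex v

/-- A labelling of the regions that turns a dessin into a dessin of type I. -/
structure IsTypeILabelling (G : TrichotomicGraph S R) (L : R → RegionType) : Prop where
  real_solid : ∀ s, G.IsRealEdge s → G.kind s = EdgeKind.solid →
    L (G.region s) ≠ RegionType.one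
  real_bold : ∀ s, G.IsRealEdge s → G.kind s = EdgeKind.bold →
    L (G.region s) ≠ RegionType.three
  inner_solid : ∀ s, ¬ G.IsRealEdge s → G.kind s = EdgeKind.solid →
    (L (G.region s) = RegionType.one ∧ L (G.region (G.twin s)) = RegionType.one) ∨
    (L (G.region s) = RegionType.two ∧ L (G.region (G.twin s)) = RegionType.three) ∨
    (L (G.region s) = RegionType.three ∧ L (G.region (G.twin s)) = RegionType.two)
  inner_bold : ∀ s, ¬ G.IsRealEdge s → G.kind s = EdgeKind.bold →
    (L (G.region s) = RegionType.three ∧ L (G.region (G.twin s)) = RegionType.three) ∨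
    (L (G.region s) = RegionType.one ∧ L (G.region (G.twin s)) = RegionType.two) ∨
    (L (G.region s) = RegionType.two ∧ L (G.region (G.twin s)) = RegionType.one)
  inner_dotted : ∀ s, ¬ G.IsRealEdge s → G.kind s = EdgeKind.dotted →
    L (G.region s) = L (G.region (G.twin s))

/-- A segment of kind `k` with end points `u` and `v`. -/
def IsSegment (G : TrichotomicGraph S R) (k : EdgeKind) (A : Set S) (u v : G.Vertex) : Prop :=
  G.IsRealArc A u v ∧ ∀ s ∈ A, G.kind s = k

/-- A maximal dotted segment: a dotted segment bounded by two cross-vertices. -/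
def IsMaximalDottedSegment (G : TrichotomicGraph S R) (A : Set S) : Prop :=
  ∃ u v, G.IsSegment EdgeKind.dotted A u v ∧
    G.vertexKind u = VertexKind.cross ∧ G.vertexKind v = VertexKind.cross

/-- A maximal bold segment: a bold segment bounded by two black vertices. -/
def IsMaximalBoldSegment (G : TrichotomicGraph S R) (A : Set S) : Prop :=
  ∃ u v, G.IsSegment EdgeKind.bold A u v ∧
    G.vertexKind u = VertexKind.black ∧ G.vertexKind v = VertexKind.black

/-- A hyperbolic component: a real component with all edges dotted. -/
def IsHyperbolicComponent (G : TrichotomicGraph S R) (A : Set S) : Prop :=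
  G.IsRealComponent A ∧ ∀ s ∈ A, G.kind s = EdgeKind.dotted

/-- A pillar, given by its set of (real) edges. -/
def IsPillar (G : TrichotomicGraph S R) (A : Set S) : Prop :=
  G.IsHyperbolicComponent A ∨ G.IsMaximalDottedSegment A ∨ G.IsMaximalBoldSegment A

/-- The number of white vertices contained in (the closure of) a set of edges. -/
noncomputable def whiteCount (G : TrichotomicGraph S R) (A : Set S) : ℕ :=
  {v | v ∈ G.verts A ∧ G.vertexKind v = VertexKind.white}.ncard

/-- An oval: an even maximal dotted segment. -/
def IsOval (G : TrichotomicGraph S R) (A : Set S) : Prop :=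
  G.IsMaximalDottedSegment A ∧ Even (G.whiteCount A)

/-- A zigzag: an odd maximal dotted segment. -/
def IsZigzag (G : TrichotomicGraph S R) (A : Set S) : Prop :=
  G.IsMaximalDottedSegment A ∧ Odd (G.whiteCount A)

/-- A jump: a white vertex `w` and a pair of real bold segments connecting it to black vertices
`u` and `v`; these three are the only essential vertices of the jump. -/
def IsJump (G : TrichotomicGraph S R) (A : Set S) : Prop :=
  ∃ u v w, G.IsSegment EdgeKind.bold A u v ∧ w ∈ G.verts A ∧
    G.vertexKind u = VertexKind.black ∧ G.vertexKind v = VertexKind.black ∧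
    G.vertexKind w = VertexKind.white ∧
    ∀ x ∈ G.verts A, G.vertexKind x ≠ VertexKind.monochrome → x = u ∨ x = w ∨ x = v

/-- A set of real edges has type `t` if all its edges have type `t`, the type of a real edge
being that of the region adjacent to it. -/
def HasType (G : TrichotomicGraph S R) (L : R → RegionType) (A : Set S) (t : RegionType) : Prop :=
  ∀ s ∈ A, L (G.region s) = t

/-- The edge with side `s` is an inner dotted edge. -/
def IsInnerDotted (G : TrichotomicGraph S R) (s : S) : Prop :=
  ¬ G.IsRealEdge s ∧ G.kind s = EdgeKind.dotted

/-- The edge with side `s` is an inner dotted edge of type `t`: both adjacent regions have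
type `t`. -/
def IsInnerDottedOfType (G : TrichotomicGraph S R) (L : R → RegionType) (s : S)
    (t : RegionType) : Prop :=
  G.IsInnerDotted s ∧ L (G.region s) = t ∧ L (G.region (G.twin s)) = t

/-- The vertex `v` belongs to a pillar of type `t`. -/
def OnPillarOfType (G : TrichotomicGraph S R) (L : R → RegionType) (v : G.Vertex)
    (t : RegionType) : Prop :=
  ∃ A, G.IsPillar A ∧ G.HasType L A t ∧ v ∈ G.verts A

/-- The vertex `v` is an inner white vertex. -/
def IsInnerWhite (G : TrichotomicGraph S R) (v : G.Vertex) : Prop :=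
  G.vertexKind v = VertexKind.white ∧ ¬ G.IsRealVertex v

/-- `A` and `B` are consecutive pillars of the real component `K`: there is an arc in `K` leading
from a vertex of `A` to a vertex of `B` and containing no edge of a pillar. (If `A` is the
only pillar of `K` and `A` is not all of `K`, then `A` is consecutive to itself.) -/
def ConsecutivePillars (G : TrichotomicGraph S R) (K A B : Set S) : Prop :=
  G.IsPillar A ∧ G.IsPillar B ∧ A ⊆ K ∧ B ⊆ K ∧
    ∃ C u v, G.IsRealArc C u v ∧ C ⊆ K ∧ u ∈ G.verts A ∧ v ∈ G.verts B ∧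
      ∀ s ∈ C, ∀ P, G.IsPillar P → s ∉ P

end TrichotomicGraph

/-! Crossing the incoming edge (`twin`) or the outgoing edge (`flip`) of a corner gives two
involutions on the corners at a vertex, which together act transitively there. Their fixed points
come from real edges, so the corners form a path at a real vertex and a cycle at an inner one, and
the prescribed valencies leave few local pictures.

The decisive fact is that the label one never occurs (`label_ne_one`). Along the boundary of a
region the kinds run solid, bold, dotted, and change at black, white and cross vertices
respectively. Since there is no oriented monochrome cycle, every region has a corner at a cross. In
an unramified dessin that corner lies between two real edges, and the solid one excludes the label
one. Hence real bold edges are of type two, inner bold edges have label three on both sides, inner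
solid edges separate two from three, and inner dotted edges have equal labels on their sides.

Consequently black vertices are real, bold monochrome vertices do not exist, and a real white vertex
has either real dotted edges and type three or real bold edges and type two (`white_edges`). Thus
every maximal bold segment is a jump (`IsMaximalBoldSegment.isJump`). A real dotted path can stop
only at a cross, so by finiteness it lies in a maximal segment or closes up to a hyperbolic
component (`exists_pillar_of_dotted`). The statements on inner dotted edges are read off from the
local pictures at their end points.

For the parity rule, all real edges outside the pillars are solid. Along a solid arc the direction
and the type change together at each inner vertex (`solid_step`). An end edge directed away from a
pillar has the type of the pillar, one directed towards it has the other type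
(`label_at_pillar_end`). Carrying this correlation along the arc forces different types at its ends.
-/

namespace SurfaceGraph

variable {S R : Type*} (G : SurfaceGraph S R)

/-! ### Corners around a vertex -/

/-- The corner on the other side of the edge that starts at the corner `s`. -/
def flip (s : S) : S := G.next.symm (G.twin (G.next s))

theorem next_flip (s : S) : G.next (G.flip s) = G.twin (G.next s) := by simp [flip]

theorem flip_flip (s : S) : G.flip (G.flip s) = s := by
  apply G.next.injective
  rw [next_flip, next_flip, G.twin_twin]

theorem flip_eq_self {s : S} : G.flip s = s ↔ G.IsRealEdge (G.next s) := by
  rw [← G.next.injective.eq_iff, next_flip, IsRealEdge]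

theorem head_twin (s : S) : G.head (G.twin s) = G.head s :=
  (Quotient.sound (s := G.cornerSetoid) (Relation.EqvGen.rel _ _ (Or.inl rfl))).symm

theorem head_flip (s : S) : G.head (G.flip s) = G.head s :=
  (Quotient.sound (s := G.cornerSetoid) (Relation.EqvGen.rel _ _ (Or.inr (G.next_flip s)))).symm

theorem tail_next (s : S) : G.tail (G.next s) = G.head s := by simp [tail]

theorem exists_next_eq (s : S) : ∃ c, G.next c = s := G.next.surjective s

/-- A property of corners that is preserved by crossing edges is constant around a vertex. -/
theorem corner_induction (P : S → Prop) (hα : ∀ t, P t → P (G.twin t))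
    (hβ : ∀ t, P t → P (G.flip t)) {s t : S} (hst : G.head s = G.head t) (h : P s) : P t := by
  have key : ∀ s t, Relation.EqvGen (fun s t => t = G.twin s ∨ G.next t = G.twin (G.next s)) s t →
      (P s ↔ P t) := by
    intro s t h
    induction h with
    | rel x y h =>
      rcases h with rfl | h
      · exact ⟨hα x, fun h => by simpa [G.twin_twin] using hα _ h⟩
      · have : y = G.flip x := by
          apply G.next.injective
          rw [next_flip, h]
        subst this
        exact ⟨hβ x, fun h => by simpa [flip_flip] using hβ _ h⟩
    | refl x => exact Iff.rfl
    | symm x y _ ih => exact ih.symm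
    | trans x y z _ _ ih₁ ih₂ => exact ih₁.trans ih₂
  exact (key s t (Quotient.exact hst)).1 h

theorem isRealVertex_iff {v : G.Vertex} :
    G.IsRealVertex v ↔ ∃ s, G.head s = v ∧ (G.twin s = s ∨ G.flip s = s) := by
  constructor
  · rintro ⟨s, hs, h | h⟩
    · exact ⟨s, h, Or.inl hs⟩
    · obtain ⟨c, rfl⟩ := G.exists_next_eq s
      exact ⟨c, by rwa [tail_next] at h, Or.inr (G.flip_eq_self.2 hs)⟩
  · rintro ⟨s, h, hs | hs⟩
    · exact ⟨s, hs, Or.inl h⟩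
    · exact ⟨G.next s, G.flip_eq_self.1 hs, Or.inr (by rwa [tail_next])⟩

theorem one_corner {v : G.Vertex} (h : G.cornerCount v = 1) {s : S} (hs : G.head s = v) :
    G.IsRealEdge s ∧ G.IsRealEdge (G.next s) ∧ ∀ t, G.head t = v → t = s := by
  obtain ⟨a, ha⟩ := Set.ncard_eq_one.1 h
  have key : ∀ t, G.head t = v ↔ t = a := fun t => by
    simpa using Set.ext_iff.1 ha t
  obtain rfl := (key s).1 hs
  refine ⟨(key _).1 ((G.head_twin s).trans hs), ?_, fun t => (key t).1⟩
  exact G.flip_eq_self.1 ((key _).1 ((G.head_flip s).trans hs))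

/-- On two points each involution is the identity or the swap. Transitivity forbids two identities,
reality of the vertex forbids two swaps. The alternatives say whether the inner edge is incoming or
outgoing; the real edges then have the opposite direction. -/
theorem two_corners {v : G.Vertex} (h : G.cornerCount v = 2) (hv : G.IsRealVertex v) :
    ∃ a b, a ≠ b ∧ (∀ t, G.head t = v ↔ t = a ∨ t = b) ∧
      ((G.twin a = b ∧ G.IsRealEdge (G.next a) ∧ G.IsRealEdge (G.next b)) ∨
       (G.IsRealEdge a ∧ G.IsRealEdge b ∧ G.twin (G.next a) = G.next b)) := by
  obtain ⟨a, b, hab, he⟩ := Set.ncard_eq_two.1 h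
  have key : ∀ t, G.head t = v ↔ t = a ∨ t = b := fun t => by
    simpa using Set.ext_iff.1 he t
  refine ⟨a, b, hab, key, ?_⟩
  have hα : ∀ t, (t = a ∨ t = b) → (G.twin t = a ∨ G.twin t = b) := fun t ht =>
    (key _).1 ((G.head_twin t).trans ((key t).2 ht))
  have hβ : ∀ t, (t = a ∨ t = b) → (G.flip t = a ∨ G.flip t = b) := fun t ht =>
    (key _).1 ((G.head_flip t).trans ((key t).2 ht))
  have hh : G.head a = G.head b := ((key a).2 (Or.inl rfl)).trans ((key b).2 (Or.inr rfl)).symm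
  -- By transitivity, a corner fixed by both involutions would be the only one at the vertex.
  have hc : ¬ (G.twin a = a ∧ G.flip a = a) := fun ⟨h1, h2⟩ =>
    hab (G.corner_induction (· = a) (by rintro _ rfl; exact h1) (by rintro _ rfl; exact h2) hh
      rfl).symm
  obtain ⟨r, hr, hr'⟩ := G.isRealVertex_iff.1 hv
  have hr := (key r).1 hr
  have ha := hα a (Or.inl rfl)
  have hb := hα b (Or.inr rfl)
  have ha' := hβ a (Or.inl rfl)
  have hb' := hβ b (Or.inr rfl)
  rw [← G.flip_eq_self, ← G.flip_eq_self, ← G.next_flip, G.next.injective.eq_iff]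
  unfold IsRealEdge
  have t1 := G.twin_twin a
  have t2 := G.flip_flip a
  have t3 := G.twin_twin b
  have t4 := G.flip_flip b
  grind

/-- The corners form a path `a`, `b`, `c` on which `flip` and `twin` alternate. Reality of the
vertex is not assumed but follows from the odd number of corners. -/
theorem three_corners {v : G.Vertex} (h : G.cornerCount v = 3) :
    ∃ a b c, a ≠ b ∧ a ≠ c ∧ b ≠ c ∧ (∀ t, G.head t = v ↔ t = a ∨ t = b ∨ t = c) ∧
      G.IsRealEdge a ∧ G.twin (G.next a) = G.next b ∧ G.twin b = c ∧ G.IsRealEdge (G.next c) := by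
  obtain ⟨x, y, z, hxy, hxz, hyz, he⟩ := Set.ncard_eq_three.1 h
  have key : ∀ t, G.head t = v ↔ t = x ∨ t = y ∨ t = z := fun t => by
    simpa using Set.ext_iff.1 he t
  have hα : ∀ t, G.head t = v → G.head (G.twin t) = v := fun t ht => (G.head_twin t).trans ht
  have hβ : ∀ t, G.head t = v → G.head (G.flip t) = v := fun t ht => (G.head_flip t).trans ht
  -- An involution of a set of three elements has a fixed point.
  obtain ⟨a, ha, haa⟩ : ∃ a, G.head a = v ∧ G.twin a = a := by
    have t1 := G.twin_twin x
    have t2 := G.twin_twin y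
    have t3 := G.twin_twin z
    have hx := hα x
    have hy := hα y
    have hz := hα z
    simp only [key] at hx hy hz ⊢
    grind
  have hsub : ∀ P : S → Prop, P a → (∀ t, P t → P (G.twin t)) → (∀ t, P t → P (G.flip t)) →
      P x ∧ P y ∧ P z := fun P h0 h1 h2 =>
    ⟨G.corner_induction P h1 h2 (ha.trans ((key x).2 (by simp)).symm) h0,
     G.corner_induction P h1 h2 (ha.trans ((key y).2 (by simp)).symm) h0,
     G.corner_induction P h1 h2 (ha.trans ((key z).2 (by simp)).symm) h0⟩
  have hab : G.flip a ≠ a := by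
    intro hf
    have := hsub (· = a) rfl (by rintro _ rfl; exact haa) (by rintro _ rfl; exact hf)
    grind
  have hba : G.twin (G.flip a) ≠ G.flip a := by
    intro hf
    have := hsub (fun t => t = a ∨ t = G.flip a) (Or.inl rfl)
      (by rintro _ (rfl | rfl); exacts [Or.inl haa, Or.inr hf])
      (by rintro _ (rfl | rfl); exacts [Or.inr rfl, Or.inl (G.flip_flip _)])
    grind
  have hca : G.twin (G.flip a) ≠ a := by
    intro hf
    have := G.twin_twin (G.flip a)
    rw [hf, haa] at this
    exact hab this.symm
  have hb := hβ a ha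
  have hc := hα _ hb
  have hd := hβ _ hc
  have hall : ∀ t, G.head t = v ↔ t = a ∨ t = G.flip a ∨ t = G.twin (G.flip a) := by
    intro t
    rw [key] at ha hb hc ⊢
    grind
  refine ⟨a, G.flip a, G.twin (G.flip a), hab.symm, hca.symm, hba.symm, hall, haa,
    (G.next_flip a).symm, rfl, ?_⟩
  rw [← flip_eq_self]
  have t1 := G.flip_flip a
  have t2 := G.flip_flip (G.twin (G.flip a))
  rw [hall] at hd
  grind

/-- Neither involution has a fixed point at an inner vertex, so the corners form a 4-cycle on which
`twin` and `flip` alternate. The two `flip` pairs are the two outgoing edges. -/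
theorem four_corners {v : G.Vertex} (h : G.cornerCount v = 4) (hv : ¬ G.IsRealVertex v) :
    ∃ b c d a, b ≠ d ∧ c ≠ d ∧ (∀ t, G.head t = v ↔ t = b ∨ t = c ∨ t = d ∨ t = a) ∧
      G.twin (G.next b) = G.next c ∧ G.twin (G.next d) = G.next a := by
  have hα : ∀ t, G.head t = v → G.head (G.twin t) = v ∧ G.twin t ≠ t := fun t ht =>
    ⟨(G.head_twin t).trans ht, fun h => hv (G.isRealVertex_iff.2 ⟨t, ht, Or.inl h⟩)⟩
  have hβ : ∀ t, G.head t = v → G.head (G.flip t) = v ∧ G.flip t ≠ t := fun t ht =>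
    ⟨(G.head_flip t).trans ht, fun h => hv (G.isRealVertex_iff.2 ⟨t, ht, Or.inr h⟩)⟩
  have hfin : {s | G.head s = v}.Finite := Set.finite_of_ncard_ne_zero (by
    rw [cornerCount] at h; omega)
  obtain ⟨a, ha⟩ : {s | G.head s = v}.Nonempty := by
    rw [← Set.ncard_pos hfin]; rw [cornerCount] at h; omega
  simp only [Set.mem_ofPred_eq] at ha
  obtain ⟨hb, hba⟩ := hα a ha
  obtain ⟨hc, hcb⟩ := hβ _ hb
  obtain ⟨hd, hdc⟩ := hα _ hc
  set b := G.twin a with b_def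
  set c := G.flip b with c_def
  set d := G.twin c with d_def
  have e1 : G.twin b = a := G.twin_twin a
  have e2 : G.flip c = b := G.flip_flip b
  have e3 : G.twin d = c := G.twin_twin c
  -- Otherwise `{a, b}` would be closed under both involutions and exhaust the corners.
  have hca : c ≠ a := by
    intro hca
    have : {s | G.head s = v} ⊆ {a, b} := by
      intro t ht
      exact G.corner_induction (fun t => t = a ∨ t = b) (by grind) (by grind)
        (ha.trans (Eq.symm ht)) (Or.inl rfl)
    have := (Set.ncard_le_ncard this (by simp)).trans (Set.ncard_insert_le a {b})
    rw [cornerCount] at h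
    rw [Set.ncard_singleton] at this
    omega
  have hda : d ≠ a := by grind
  have hdb : d ≠ b := by grind
  have hset : ({a, b, c, d} : Set S) = {s | G.head s = v} := by
    apply Set.eq_of_subset_of_ncard_le _ _ hfin
    · intro t ht
      simp only [Set.mem_insert_iff, Set.mem_singleton_iff] at ht
      rcases ht with rfl | rfl | rfl | rfl <;> assumption
    · rw [cornerCount] at h
      rw [h, Set.ncard_insert_of_notMem, Set.ncard_insert_of_notMem, Set.ncard_pair] <;> grind
  have key : ∀ t, G.head t = v ↔ t = a ∨ t = b ∨ t = c ∨ t = d := fun t => by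
    simpa using (Set.ext_iff.1 hset t).symm
  have hf : G.flip d = a := by
    obtain ⟨h1, h2⟩ := hβ d hd
    rw [key] at h1
    have := G.flip_flip d
    grind
  refine ⟨b, c, d, a, hdb.symm, hdc.symm, fun t => by rw [key]; tauto, ?_, ?_⟩
  · rw [← next_flip]
  · rw [← next_flip, hf]

end SurfaceGraph

namespace TrichotomicGraph

open SurfaceGraph

variable {S R : Type*} {G : TrichotomicGraph S R} {L : R → RegionType}

/-! ### Every region has a corner at a cross -/

/-- By finiteness the iterates of `next` return to `s`. If all corners met were monochrome, the
boundary circle would be an oriented monochrome cycle. -/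
theorem exists_iterate_ne_monochrome [Finite S] (hG : G.IsDessin) (s : S) :
    ∃ n : ℕ, G.vertexKind (G.head (G.next^[n] s)) ≠ VertexKind.monochrome := by
  by_contra! h
  apply hG.no_oriented_monochrome_cycle
  have hstep : ∀ n : ℕ, Relation.TransGen
      (fun u w => G.vertexKind u = VertexKind.monochrome ∧ G.vertexKind w = VertexKind.monochrome ∧
        ∃ s, G.tail s = u ∧ G.head s = w) (G.head s) (G.head (G.next^[n + 1] s)) := by
    intro n
    induction n with
    | zero => exact .single ⟨h 0, h 1, G.next s, G.tail_next s, rfl⟩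
    | succ n ih =>
      refine ih.tail ⟨h _, h _, G.next^[n + 1 + 1] s, ?_, rfl⟩
      rw [Function.iterate_succ_apply', tail_next]
  obtain ⟨n, hn, hp⟩ := Function.Injective.mem_periodicPts G.next.injective s
  refine ⟨G.head s, ?_⟩
  -- The chain needs at least one step, so `hstep` is indexed by the period minus one.
  have := hstep (n - 1)
  rwa [Nat.sub_add_cancel hn, hp] at this

theorem region_iterate (n : ℕ) (s : S) : G.region (G.next^[n] s) = G.region s := by
  induction n with
  | zero => rfl
  | succ n ih => rw [Function.iterate_succ_apply', G.region_next, ih]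

theorem kind_next_of_monochrome {s : S} (h : G.vertexKind (G.head s) = VertexKind.monochrome) :
    G.kind (G.next s) = G.kind s :=
  G.monochrome_kind _ h _ _ (Or.inr (G.tail_next s)) (Or.inl rfl)

/-- Following the boundary of a region from `s`, one meets an essential corner at the end of an
edge of the same kind as `s`. -/
theorem exists_essential_corner [Finite S] (hG : G.IsDessin) (s : S) :
    ∃ t, G.region t = G.region s ∧ G.kind t = G.kind s ∧
      G.vertexKind (G.head t) ≠ VertexKind.monochrome := by
  classical
  have hex := exists_iterate_ne_monochrome hG s
  refine ⟨_, region_iterate (Nat.find hex) s, ?_, Nat.find_spec hex⟩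
  have : ∀ n ≤ Nat.find hex, G.kind (G.next^[n] s) = G.kind s := by
    intro n
    induction n with
    | zero => exact fun _ => rfl
    | succ n ih =>
      intro hn
      rw [Function.iterate_succ_apply', kind_next_of_monochrome, ih (by omega)]
      simpa using Nat.find_min hex (Nat.lt_of_succ_le hn)
  exact this _ le_rfl

theorem kind_next_of_black {s : S} (h : G.vertexKind (G.head s) = VertexKind.black) :
    G.kind (G.next s) = EdgeKind.bold :=
  G.black_out _ (by rwa [tail_next])

theorem kind_next_of_white {s : S} (h : G.vertexKind (G.head s) = VertexKind.white) :
    G.kind (G.next s) = EdgeKind.dotted :=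
  G.white_out _ (by rwa [tail_next])

theorem kind_next_of_cross {s : S} (h : G.vertexKind (G.head s) = VertexKind.cross) :
    G.kind (G.next s) = EdgeKind.solid :=
  G.cross_out _ (by rwa [tail_next])

theorem exists_cross_corner_of_dotted [Finite S] (hG : G.IsDessin) {s : S}
    (hs : G.kind s = EdgeKind.dotted) :
    ∃ t, G.region t = G.region s ∧ G.vertexKind (G.head t) = VertexKind.cross := by
  obtain ⟨t, ht, hk, hm⟩ := exists_essential_corner hG s
  refine ⟨t, ht, ?_⟩
  have h1 := G.black_in t
  have h2 := G.white_in t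
  cases h : G.vertexKind (G.head t) <;> simp_all

theorem exists_cross_corner_of_bold [Finite S] (hG : G.IsDessin) {s : S}
    (hs : G.kind s = EdgeKind.bold) :
    ∃ t, G.region t = G.region s ∧ G.vertexKind (G.head t) = VertexKind.cross := by
  obtain ⟨t, ht, hk, hm⟩ := exists_essential_corner hG s
  have hw : G.vertexKind (G.head t) = VertexKind.white := by
    have h1 := G.black_in t
    have h2 := G.cross_in t
    cases h : G.vertexKind (G.head t) <;> simp_all
  obtain ⟨u, hu, hc⟩ := exists_cross_corner_of_dotted hG (kind_next_of_white hw)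
  exact ⟨u, by rw [hu, G.region_next, ht], hc⟩

/-- A solid edge can enter only a black essential vertex, a bold one only a white vertex, a dotted
one only a cross. From any starting kind at most three essential corners are needed to reach a
cross. -/
theorem exists_cross_corner [Finite S] (hG : G.IsDessin) (s : S) :
    ∃ t, G.region t = G.region s ∧ G.vertexKind (G.head t) = VertexKind.cross := by
  cases hs : G.kind s
  case dotted => exact exists_cross_corner_of_dotted hG hs
  case bold => exact exists_cross_corner_of_bold hG hs
  case solid =>
    obtain ⟨t, ht, hk, hm⟩ := exists_essential_corner hG s
    have hw : G.vertexKind (G.head t) = VertexKind.black := by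
      have h1 := G.white_in t
      have h2 := G.cross_in t
      cases h : G.vertexKind (G.head t) <;> simp_all
    obtain ⟨u, hu, hc⟩ := exists_cross_corner_of_bold hG (kind_next_of_black hw)
    exact ⟨u, by rw [hu, G.region_next, ht], hc⟩

/-! ### Only the types two and three occur -/

/-- Full valencies 2, 4, 6 thus mean one, two, three corners at a real vertex. -/
theorem cornerCount_of_real {v : G.Vertex} (h : G.IsRealVertex v) :
    G.fullValency v = 2 * G.cornerCount v := by
  simp only [fullValency, valency, h, if_true]
  omega

theorem cornerCount_of_inner {v : G.Vertex} (h : ¬ G.IsRealVertex v) :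
    G.fullValency v = G.cornerCount v := by
  simp only [fullValency, valency, h, if_false]

theorem cross_corner (hG : G.IsDessin) (hU : G.IsUnramified) {s : S}
    (hs : G.vertexKind (G.head s) = VertexKind.cross) :
    G.IsRealEdge s ∧ G.IsRealEdge (G.next s) ∧ ∀ t, G.head t = G.head s → t = s := by
  apply G.one_corner _ rfl
  have := cornerCount_of_real (hU _ hs)
  rw [hG.cross_fullValency _ hs] at this
  omega

/-- In an unramified dessin of type I no region is of type one. -/
theorem label_ne_one [Finite S] (hG : G.IsDessin) (hU : G.IsUnramified)
    (hL : G.IsTypeILabelling L) (s : S) : L (G.region s) ≠ RegionType.one := by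
  obtain ⟨t, ht, hc⟩ := exists_cross_corner hG s
  rw [← ht, ← G.region_next]
  exact hL.real_solid _ (cross_corner hG hU hc).2.1 (kind_next_of_cross hc)

theorem label_two_or_three [Finite S] (hG : G.IsDessin) (hU : G.IsUnramified)
    (hL : G.IsTypeILabelling L) (s : S) :
    L (G.region s) = RegionType.two ∨ L (G.region s) = RegionType.three := by
  have := label_ne_one hG hU hL s
  cases h : L (G.region s) <;> simp_all

theorem label_inner_bold [Finite S] (hG : G.IsDessin) (hU : G.IsUnramified)
    (hL : G.IsTypeILabelling L) {s : S} (hs : ¬ G.IsRealEdge s) (hk : G.kind s = EdgeKind.bold) :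
    L (G.region s) = RegionType.three := by
  have h1 := label_ne_one hG hU hL s
  have h2 := label_ne_one hG hU hL (G.twin s)
  have := hL.inner_bold s hs hk
  tauto

theorem label_real_bold [Finite S] (hG : G.IsDessin) (hU : G.IsUnramified)
    (hL : G.IsTypeILabelling L) {s : S} (hs : G.IsRealEdge s) (hk : G.kind s = EdgeKind.bold) :
    L (G.region s) = RegionType.two :=
  (label_two_or_three hG hU hL s).resolve_right (hL.real_bold s hs hk)

theorem label_inner_solid [Finite S] (hG : G.IsDessin) (hU : G.IsUnramified)
    (hL : G.IsTypeILabelling L) {s : S} (hs : ¬ G.IsRealEdge s) (hk : G.kind s = EdgeKind.solid) :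
    L (G.region (G.twin s)) ≠ L (G.region s) := by
  have h1 := label_ne_one hG hU hL s
  rcases hL.inner_solid s hs hk with h | h | h <;> rw [h.1, h.2] <;> simp_all

/-! ### Local pictures at black, monochrome and white vertices -/

theorem isRealVertex_head {s : S} (h : G.IsRealEdge s) : G.IsRealVertex (G.head s) :=
  ⟨s, h, Or.inl rfl⟩

/-- At an inner black vertex every corner borders an inner bold edge and so has label three. But the
inner solid edges there must separate two different labels. -/
theorem isRealVertex_of_black [Finite S] (hG : G.IsDessin) (hU : G.IsUnramified)
    (hL : G.IsTypeILabelling L) {v : G.Vertex} (hv : G.vertexKind v = VertexKind.black) :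
    G.IsRealVertex v := by
  by_contra hr
  obtain ⟨s, rfl⟩ := Quotient.exists_rep v
  change G.vertexKind (G.head s) = _ at hv
  change ¬ G.IsRealVertex (G.head s) at hr
  have h3 : ∀ t, G.head t = G.head s → L (G.region t) = RegionType.three := by
    intro t ht
    rw [← G.region_next]
    refine label_inner_bold hG hU hL (fun h => hr ⟨_, h, Or.inr ?_⟩)
      (kind_next_of_black (by rwa [ht]))
    rw [tail_next, ht]
  refine label_inner_solid hG hU hL (fun h => hr ⟨s, h, Or.inl rfl⟩) (G.black_in s hv) ?_
  rw [h3 _ (G.head_twin s), h3 _ rfl]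

theorem black_corners [Finite S] (hG : G.IsDessin) (hU : G.IsUnramified)
    (hL : G.IsTypeILabelling L) {v : G.Vertex} (hv : G.vertexKind v = VertexKind.black) :
    ∃ a b c, a ≠ b ∧ a ≠ c ∧ b ≠ c ∧ (∀ t, G.head t = v ↔ t = a ∨ t = b ∨ t = c) ∧
      G.IsRealEdge a ∧ G.twin (G.next a) = G.next b ∧ G.twin b = c ∧ G.IsRealEdge (G.next c) := by
  apply G.three_corners
  have := cornerCount_of_real (isRealVertex_of_black hG hU hL hv)
  rw [hG.black_fullValency _ hv] at this
  omega

/-- Of the three outgoing sides, two belong to one inner bold edge. Hence a real bold path cannot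
pass through a black vertex. -/
theorem black_out_unique [Finite S] (hG : G.IsDessin) (hU : G.IsUnramified)
    (hL : G.IsTypeILabelling L) {s t : S} (hs : G.IsRealEdge s) (ht : G.IsRealEdge t)
    (hv : G.vertexKind (G.tail s) = VertexKind.black) (h : G.tail s = G.tail t) : s = t := by
  obtain ⟨a, b, c, hab, -, -, key, -, h2, -, -⟩ := black_corners hG hU hL hv
  have : ∀ r, G.IsRealEdge r → G.tail r = G.tail s → r = G.next c := by
    intro r hr hrv
    obtain ⟨x, rfl⟩ := G.exists_next_eq r
    rw [tail_next, key] at hrv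
    rcases hrv with rfl | rfl | rfl
    · exact absurd (G.next.injective (hr.symm.trans h2)) hab
    · refine absurd (G.next.injective (hr.symm.trans ?_)) hab.symm
      rw [← h2, G.twin_twin]
    · rfl
  rw [this s hs rfl, this t ht h.symm]

theorem black_in_unique [Finite S] (hG : G.IsDessin) (hU : G.IsUnramified)
    (hL : G.IsTypeILabelling L) {s t : S} (hs : G.IsRealEdge s) (ht : G.IsRealEdge t)
    (hv : G.vertexKind (G.head s) = VertexKind.black) (h : G.head s = G.head t) : s = t := by
  obtain ⟨a, b, c, -, -, hbc, key, -, -, h2, -⟩ := black_corners hG hU hL hv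
  have : ∀ r, G.IsRealEdge r → G.head r = G.head s → r = a := by
    intro r hr hrv
    rw [key] at hrv
    rcases hrv with rfl | rfl | rfl
    · rfl
    · exact absurd (hr.symm.trans h2) hbc
    · refine absurd (hr.symm.trans ?_) hbc.symm
      rw [← h2, G.twin_twin]
  rw [this s hs rfl, this t ht h.symm]

/-- The real solid edge at a black vertex is of type three. -/
theorem label_black_in [Finite S] (hG : G.IsDessin) (hU : G.IsUnramified)
    (hL : G.IsTypeILabelling L) {s : S} (hs : G.IsRealEdge s)
    (hv : G.vertexKind (G.head s) = VertexKind.black) : L (G.region s) = RegionType.three := by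
  obtain ⟨a, b, c, hab, hac, hbc, key, ha, h2, -, -⟩ := black_corners hG hU hL hv
  obtain rfl := black_in_unique hG hU hL hs ha hv ((key a).2 (Or.inl rfl)).symm
  rw [← G.region_next]
  exact label_inner_bold hG hU hL (fun h => hab (G.next.injective (h.symm.trans h2)))
    (kind_next_of_black hv)

/-- The corners at a real white or monochrome vertex. -/
theorem two_corners_of_kind (hG : G.IsDessin) {v : G.Vertex} (hr : G.IsRealVertex v)
    (hv : G.vertexKind v = VertexKind.white ∨ G.vertexKind v = VertexKind.monochrome) :
    ∃ a b, a ≠ b ∧ (∀ t, G.head t = v ↔ t = a ∨ t = b) ∧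
      ((G.twin a = b ∧ G.IsRealEdge (G.next a) ∧ G.IsRealEdge (G.next b)) ∨
       (G.IsRealEdge a ∧ G.IsRealEdge b ∧ G.twin (G.next a) = G.next b)) := by
  refine G.two_corners ?_ hr
  rcases hv with hv | hv
  · have := cornerCount_of_real hr
    rw [hG.white_fullValency _ hv] at this
    omega
  · have := hG.real_monochrome_valency _ hv hr
    rw [valency, if_pos hr] at this
    omega

/-- There are no bold monochrome vertices. -/
theorem ne_monochrome_of_bold [Finite S] (hG : G.IsDessin) (hU : G.IsUnramified)
    (hL : G.IsTypeILabelling L) {s : S} (hs : G.kind s = EdgeKind.bold) {v : G.Vertex}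
    (hi : G.Incident s v) : G.vertexKind v ≠ VertexKind.monochrome := by
  intro hv
  have hk : ∀ t, G.Incident t v → G.kind t = EdgeKind.bold := fun t ht =>
    (G.monochrome_kind v hv t s ht hi).trans hs
  obtain ⟨a, b, hab, key, h⟩ := two_corners_of_kind hG (hG.no_inner_monochrome v hv) (Or.inr hv)
  have ha := (key a).2 (Or.inl rfl)
  have hka := hk a (Or.inl ha)
  have hkn := hk (G.next a) (Or.inr (by rw [tail_next, ha]))
  -- In either case the corner `a` lies between an inner bold edge, forcing label three, and a real
  -- bold edge, forcing label two.
  rcases h with ⟨h1, h2, -⟩ | ⟨h1, h2, h3⟩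
  · have e1 := label_inner_bold hG hU hL (fun h => hab (h.symm.trans h1)) hka
    have e2 := label_real_bold hG hU hL h2 hkn
    rw [G.region_next, e1] at e2
    cases e2
  · have e1 := label_real_bold hG hU hL h1 hka
    have e2 := label_inner_bold hG hU hL (fun h => hab (G.next.injective (h.symm.trans h3))) hkn
    rw [G.region_next, e1] at e2
    cases e2

/-- A bold edge leads from a black vertex to a white one. -/
theorem bold_ends [Finite S] (hG : G.IsDessin) (hU : G.IsUnramified)
    (hL : G.IsTypeILabelling L) {s : S} (hs : G.kind s = EdgeKind.bold) :
    G.vertexKind (G.tail s) = VertexKind.black ∧ G.vertexKind (G.head s) = VertexKind.white := by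
  have h1 := ne_monochrome_of_bold hG hU hL hs (Or.inl rfl)
  have h2 := ne_monochrome_of_bold hG hU hL hs (Or.inr rfl)
  have e1 := G.cross_in s
  have e2 := G.cross_out s
  have e3 := G.black_in s
  have e4 := G.white_out s
  cases h : G.vertexKind (G.tail s) <;> cases h' : G.vertexKind (G.head s) <;> simp_all

theorem dotted_tail {s : S} (hs : G.kind s = EdgeKind.dotted) :
    G.vertexKind (G.tail s) = VertexKind.white ∨
      G.vertexKind (G.tail s) = VertexKind.monochrome := by
  have e2 := G.cross_out s
  have e3 := G.black_out s
  cases h : G.vertexKind (G.tail s) <;> simp_all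

theorem dotted_head {s : S} (hs : G.kind s = EdgeKind.dotted) :
    G.vertexKind (G.head s) = VertexKind.cross ∨
      G.vertexKind (G.head s) = VertexKind.monochrome := by
  have e2 := G.white_in s
  have e3 := G.black_in s
  cases h : G.vertexKind (G.head s) <;> simp_all

theorem solid_tail {s : S} (hs : G.kind s = EdgeKind.solid) :
    G.vertexKind (G.tail s) = VertexKind.cross ∨
      G.vertexKind (G.tail s) = VertexKind.monochrome := by
  have e2 := G.white_out s
  have e3 := G.black_out s
  cases h : G.vertexKind (G.tail s) <;> simp_all

theorem solid_head {s : S} (hs : G.kind s = EdgeKind.solid) :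
    G.vertexKind (G.head s) = VertexKind.black ∨
      G.vertexKind (G.head s) = VertexKind.monochrome := by
  have e2 := G.white_in s
  have e3 := G.cross_in s
  cases h : G.vertexKind (G.head s) <;> simp_all

/-- A monochrome vertex is either the common tail of its two real edges or their common head; the
third edge is inner. -/
theorem monochrome_edges (hG : G.IsDessin) {v : G.Vertex}
    (hv : G.vertexKind v = VertexKind.monochrome) :
    (∃ a b, a ≠ b ∧ G.IsRealEdge a ∧ G.IsRealEdge b ∧ G.tail a = v ∧ G.tail b = v ∧
      (∀ t, G.IsRealEdge t → G.Incident t v → t = a ∨ t = b) ∧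
      ∃ c, ¬ G.IsRealEdge c ∧ G.head c = v ∧ G.region c = G.region a ∧
        G.region (G.twin c) = G.region b ∧
        ∀ t, ¬ G.IsRealEdge t → G.Incident t v → t = c ∨ t = G.twin c) ∨
    (∃ a b, a ≠ b ∧ G.IsRealEdge a ∧ G.IsRealEdge b ∧ G.head a = v ∧ G.head b = v ∧
      (∀ t, G.IsRealEdge t → G.Incident t v → t = a ∨ t = b) ∧
      ∃ c, ¬ G.IsRealEdge c ∧ G.tail c = v ∧ G.region c = G.region a ∧
        G.region (G.twin c) = G.region b ∧
        ∀ t, ¬ G.IsRealEdge t → G.Incident t v → t = c ∨ t = G.twin c) := by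
  obtain ⟨a, b, hab, key, h⟩ := two_corners_of_kind hG (hG.no_inner_monochrome v hv) (Or.inr hv)
  have ha := (key a).2 (Or.inl rfl)
  have hb := (key b).2 (Or.inr rfl)
  have hinc : ∀ t, G.Incident t v → t = a ∨ t = b ∨ t = G.next a ∨ t = G.next b := by
    rintro t (ht | ht)
    · rw [key] at ht
      tauto
    · obtain ⟨x, rfl⟩ := G.exists_next_eq t
      rw [tail_next, key] at ht
      rcases ht with rfl | rfl <;> simp
  have hnab : G.next a ≠ G.next b := fun h => hab (G.next.injective h)
  rcases h with ⟨h1, h2, h3⟩ | ⟨h1, h2, h3⟩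
  · have hia : ¬ G.IsRealEdge a := fun h => hab (h.symm.trans h1)
    have hib : ¬ G.IsRealEdge b := fun h => by
      rw [← h1, IsRealEdge, G.twin_twin] at h
      exact hab (h.trans h1)
    refine Or.inl ⟨G.next a, G.next b, hnab, h2, h3, (G.tail_next a).trans ha,
      (G.tail_next b).trans hb, ?_, a, hia, ha, (G.region_next a).symm, ?_, ?_⟩
    · intro t ht hi
      rcases hinc t hi with rfl | rfl | h | h
      exacts [absurd ht hia, absurd ht hib, Or.inl h, Or.inr h]
    · rw [h1, G.region_next]
    · intro t ht hi
      rcases hinc t hi with h | h | rfl | rfl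
      exacts [Or.inl h, Or.inr (h.trans h1.symm), absurd h2 ht, absurd h3 ht]
  · have hia : ¬ G.IsRealEdge (G.next a) := fun h => hnab (h.symm.trans h3)
    have hib : ¬ G.IsRealEdge (G.next b) := fun h => by
      rw [← h3, IsRealEdge, G.twin_twin] at h
      exact hnab (h.trans h3)
    refine Or.inr ⟨a, b, hab, h1, h2, ha, hb, ?_, G.next a, hia, (G.tail_next a).trans ha,
      G.region_next a, ?_, ?_⟩
    · intro t ht hi
      rcases hinc t hi with h | h | rfl | rfl
      exacts [Or.inl h, Or.inr h, absurd ht hia, absurd ht hib]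
    · rw [h3, G.region_next]
    · intro t ht hi
      rcases hinc t hi with rfl | rfl | h | h
      exacts [absurd h1 ht, absurd h2 ht, Or.inl h, Or.inr (h.trans h3.symm)]

/-- A real white vertex is either the common tail of its two real edges, which are dotted and of
type three, or the common head of its two real edges, which are bold and of type two. -/
theorem white_edges [Finite S] (hG : G.IsDessin) (hU : G.IsUnramified)
    (hL : G.IsTypeILabelling L) {v : G.Vertex} (hr : G.IsRealVertex v)
    (hv : G.vertexKind v = VertexKind.white) :
    (∃ a b, a ≠ b ∧ G.IsRealEdge a ∧ G.IsRealEdge b ∧ G.tail a = v ∧ G.tail b = v ∧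
      (∀ t, G.kind t = EdgeKind.dotted → G.Incident t v → t = a ∨ t = b) ∧
      (∀ t, G.IsRealEdge t → G.Incident t v → t = a ∨ t = b) ∧
      ∀ t, G.head t = v ∨ G.tail t = v → L (G.region t) = RegionType.three) ∨
    (∃ a b, a ≠ b ∧ G.IsRealEdge a ∧ G.IsRealEdge b ∧ G.head a = v ∧ G.head b = v ∧
      (∀ t, G.IsRealEdge t → G.Incident t v → t = a ∨ t = b) ∧
      (∃ c, ¬ G.IsRealEdge c ∧ G.tail c = v) ∧
      ∀ t, G.head t = v ∨ G.tail t = v → L (G.region t) = RegionType.two) := by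
  obtain ⟨a, b, hab, key, h⟩ := two_corners_of_kind hG hr (Or.inl hv)
  have ha := (key a).2 (Or.inl rfl)
  have hb := (key b).2 (Or.inr rfl)
  have hbold : ∀ t, G.head t = v → G.kind t = EdgeKind.bold := fun t ht =>
    G.white_in t (by rwa [ht])
  have hout : ∀ t, G.tail t = v → t = G.next a ∨ t = G.next b := by
    intro t ht
    obtain ⟨x, rfl⟩ := G.exists_next_eq t
    rw [tail_next, key] at ht
    rcases ht with rfl | rfl <;> simp
  have hnab : G.next a ≠ G.next b := fun h => hab (G.next.injective h)
  have hlab : ∀ l, L (G.region a) = l → L (G.region b) = l →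
      ∀ t, G.head t = v ∨ G.tail t = v → L (G.region t) = l := by
    rintro l h1 h2 t (ht | ht)
    · rcases (key t).1 ht with rfl | rfl <;> assumption
    · rcases hout t ht with rfl | rfl <;> rwa [G.region_next]
  rcases h with ⟨h1, h2, h3⟩ | ⟨h1, h2, h3⟩
  · have hia : ¬ G.IsRealEdge a := fun h => hab (h.symm.trans h1)
    have hib : ¬ G.IsRealEdge b := fun h => by
      rw [← h1, IsRealEdge, G.twin_twin] at h
      exact hab (h.trans h1)
    refine Or.inl ⟨G.next a, G.next b, hnab, h2, h3, (G.tail_next a).trans ha,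
      (G.tail_next b).trans hb, ?_, ?_, ?_⟩
    · rintro t ht (hi | hi)
      · rw [hbold t hi] at ht
        cases ht
      · exact hout t hi
    · rintro t ht (hi | hi)
      · rcases (key t).1 hi with rfl | rfl
        exacts [absurd ht hia, absurd ht hib]
      · exact hout t hi
    · exact hlab _ (label_inner_bold hG hU hL hia (hbold a ha))
        (label_inner_bold hG hU hL hib (hbold b hb))
  · have hia : ¬ G.IsRealEdge (G.next a) := fun h => hnab (h.symm.trans h3)
    have hib : ¬ G.IsRealEdge (G.next b) := fun h => by
      rw [← h3, IsRealEdge, G.twin_twin] at h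
      exact hnab (h.trans h3)
    refine Or.inr ⟨a, b, hab, h1, h2, ha, hb, ?_, ⟨_, hia, (G.tail_next a).trans ha⟩, ?_⟩
    · rintro t ht (hi | hi)
      · exact (key t).1 hi
      · rcases hout t hi with rfl | rfl
        exacts [absurd ht hia, absurd ht hib]
    · exact hlab _ (label_real_bold hG hU hL h1 (hbold a ha))
        (label_real_bold hG hU hL h2 (hbold b hb))

end TrichotomicGraph

/-! ### Arcs as sequences of real edges -/

namespace SurfaceGraph

variable {S R : Type*} (G : SurfaceGraph S R)

/-- The real edges `e 0, …, e n` join consecutive members of the sequence `p 0, …, p (n + 1)` of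
pairwise distinct vertices. -/
structure IsArcSeq (n : ℕ) (p : ℕ → G.Vertex) (e : ℕ → S) : Prop where
  inj : ∀ i ≤ n + 1, ∀ j ≤ n + 1, p i = p j → i = j
  real : ∀ i ≤ n, G.IsRealEdge (e i)
  ends : ∀ i ≤ n, (G.tail (e i) = p i ∧ G.head (e i) = p (i + 1)) ∨
    (G.head (e i) = p i ∧ G.tail (e i) = p (i + 1))

variable {G}

/-- Indexing by `ℕ` with explicit bounds makes reversal and extension of arcs easy. The values of
`p` beyond `n + 1` and of `e` beyond `n` are irrelevant. -/
theorem isRealArc_iff {A : Set S} {u v : G.Vertex} :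
    G.IsRealArc A u v ↔ ∃ n p e, G.IsArcSeq n p e ∧ p 0 = u ∧ p (n + 1) = v ∧
      A = {t | ∃ i ≤ n, e i = t} := by
  constructor
  · rintro ⟨n, p, e, hp, h0, h1, hr, he, rfl⟩
    have hp' : ∀ i (hi : i < n + 2), p (Fin.ofNat (n + 2) i) = p ⟨i, hi⟩ := fun i hi => by
      congr 1; ext; exact Nat.mod_eq_of_lt hi
    have he' : ∀ i (hi : i < n + 1), e (Fin.ofNat (n + 1) i) = e ⟨i, hi⟩ := fun i hi => by
      congr 1; ext; exact Nat.mod_eq_of_lt hi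
    refine ⟨n, fun i => p (Fin.ofNat (n + 2) i), fun i => e (Fin.ofNat (n + 1) i),
      ⟨?_, ?_, ?_⟩, h0, ?_, ?_⟩
    · intro i hi j hj hij
      simp only [hp' i (by omega), hp' j (by omega)] at hij
      simpa using hp hij
    · exact fun i _ => hr _
    · intro i hi
      simp only [he' i (by omega), hp' i (by omega), hp' (i + 1) (by omega)]
      exact he ⟨i, by omega⟩
    · simp only [hp' (n + 1) (by omega)]
      exact h1
    · ext t
      constructor
      · rintro ⟨i, rfl⟩
        exact ⟨i, by omega, by simp only [he' i i.2]⟩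
      · rintro ⟨i, -, rfl⟩
        exact ⟨_, rfl⟩
  · rintro ⟨n, p, e, h, h0, h1, rfl⟩
    refine ⟨n, fun i => p i, fun i => e i, ?_, h0, h1, fun i => h.real _ (by omega),
      fun i => by simpa using h.ends i (by omega), ?_⟩
    · intro i j hij
      exact Fin.ext (h.inj _ (by omega) _ (by omega) hij)
    · ext t
      constructor
      · rintro ⟨i, hi, rfl⟩
        exact ⟨⟨i, by omega⟩, rfl⟩
      · rintro ⟨i, rfl⟩
        exact ⟨i, by omega, rfl⟩

namespace IsArcSeq

variable {n : ℕ} {p : ℕ → G.Vertex} {e : ℕ → S}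

theorem incident_left (h : G.IsArcSeq n p e) {i : ℕ} (hi : i ≤ n) : G.Incident (e i) (p i) := by
  rcases h.ends i hi with h | h
  exacts [Or.inr h.1, Or.inl h.1]

theorem incident_right (h : G.IsArcSeq n p e) {i : ℕ} (hi : i ≤ n) :
    G.Incident (e i) (p (i + 1)) := by
  rcases h.ends i hi with h | h
  exacts [Or.inl h.2, Or.inr h.2]

theorem eq_of_incident (h : G.IsArcSeq n p e) {i : ℕ} (hi : i ≤ n) {v : G.Vertex}
    (hv : G.Incident (e i) v) : v = p i ∨ v = p (i + 1) := by
  rcases h.ends i hi with h | h <;> rcases hv with rfl | rfl <;> simp [h]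

theorem ne_succ (h : G.IsArcSeq n p e) {i : ℕ} (hi : i + 1 ≤ n) : e i ≠ e (i + 1) := by
  intro he
  have h1 := h.incident_left (i := i) (by omega)
  rw [he] at h1
  rcases h.eq_of_incident hi h1 with h2 | h2
  · have := h.inj _ (by omega) _ (by omega) h2
    omega
  · have := h.inj _ (by omega) _ (by omega) h2
    omega

theorem reverse (h : G.IsArcSeq n p e) :
    G.IsArcSeq n (fun i => p (n + 1 - i)) (fun i => e (n - i)) where
  inj i hi j hj hij := by
    have := h.inj _ (by omega) _ (by omega) hij
    omega
  real i hi := h.real _ (by omega)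
  ends i hi := by
    have := h.ends (n - i) (by omega)
    rw [show n + 1 - i = n - i + 1 by omega, show n + 1 - (i + 1) = n - i by omega]
    tauto

theorem cons (h : G.IsArcSeq n p e) {x : G.Vertex} {s : S} (hs : G.IsRealEdge s)
    (hx : ∀ i ≤ n + 1, p i ≠ x)
    (he : (G.tail s = x ∧ G.head s = p 0) ∨ (G.head s = x ∧ G.tail s = p 0)) :
    G.IsArcSeq (n + 1) (fun i => Nat.casesOn i x p) (fun i => Nat.casesOn i s e) where
  inj i hi j hj hij := by
    rcases i with _ | i <;> rcases j with _ | j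
    · rfl
    · exact absurd hij.symm (hx j (by omega))
    · exact absurd hij (hx i (by omega))
    · rw [h.inj i (by omega) j (by omega) hij]
  real i hi := by
    rcases i with _ | i
    · exact hs
    · exact h.real i (by omega)
  ends i hi := by
    rcases i with _ | i
    · exact he
    · exact h.ends i (by omega)

end IsArcSeq

end SurfaceGraph

/-! ### Every real dotted or bold edge lies on a pillar -/

namespace TrichotomicGraph

open SurfaceGraph

variable {S R : Type*} {G : TrichotomicGraph S R} {L : R → RegionType}

theorem eq_of_incident_cross (hG : G.IsDessin) (hU : G.IsUnramified) {v : G.Vertex}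
    (hv : G.vertexKind v = VertexKind.cross) {s : S} (hs : G.kind s = EdgeKind.dotted)
    (hi : G.Incident s v) : G.head s = v ∧ G.IsRealEdge s ∧ ∀ t, G.head t = v → t = s := by
  rcases hi with rfl | rfl
  · exact ⟨rfl, (cross_corner hG hU hv).1, (cross_corner hG hU hv).2.2⟩
  · rw [G.cross_out s hv] at hs
    cases hs

theorem dotted_vertex {s : S} (hs : G.kind s = EdgeKind.dotted) {v : G.Vertex}
    (hi : G.Incident s v) : G.vertexKind v = VertexKind.cross ∨
      G.vertexKind v = VertexKind.white ∨ G.vertexKind v = VertexKind.monochrome := by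
  rcases hi with rfl | rfl
  · rcases dotted_head hs with h | h <;> simp [h]
  · rcases dotted_tail hs with h | h <;> simp [h]

/-- The vertex of a dotted loop would have to be monochrome, where the real edges are either both
incoming or both outgoing. -/
theorem tail_ne_head_of_dotted (hG : G.IsDessin) {s : S} (hr : G.IsRealEdge s)
    (hs : G.kind s = EdgeKind.dotted) : G.tail s ≠ G.head s := by
  intro h
  have h1 := dotted_head hs
  have h2 := dotted_tail hs
  rw [h] at h2
  have hm : G.vertexKind (G.head s) = VertexKind.monochrome := by
    rcases h1 with h1 | h1
    · simp [h1] at h2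
    · exact h1
  obtain ⟨a, b, hab, key, h'⟩ := two_corners_of_kind hG (isRealVertex_head hr) (Or.inr hm)
  obtain ⟨c, rfl⟩ := G.exists_next_eq s
  have k1 := (key _).1 rfl
  rw [← h, tail_next] at key
  have k2 := (key _).1 rfl
  have t1 := G.twin_twin a
  have t2 := G.twin_twin (G.next a)
  have hn := G.next.injective (a₁ := a) (a₂ := b)
  unfold IsRealEdge at *
  grind

/-- A dotted real path continues through each vertex other than a cross. -/
theorem exists_other_dotted [Finite S] (hG : G.IsDessin) (hU : G.IsUnramified)
    (hL : G.IsTypeILabelling L) {v : G.Vertex} (hv : G.vertexKind v ≠ VertexKind.cross) {s : S}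
    (hr : G.IsRealEdge s) (hs : G.kind s = EdgeKind.dotted) (hi : G.Incident s v) :
    ∃ t, t ≠ s ∧ G.IsRealEdge t ∧ G.kind t = EdgeKind.dotted ∧ G.Incident t v ∧
      ∀ r, G.IsRealEdge r → G.Incident r v → r = s ∨ r = t := by
  have main : ∀ a b, a ≠ b → G.IsRealEdge a → G.IsRealEdge b → G.Incident a v → G.Incident b v →
      G.kind a = EdgeKind.dotted → G.kind b = EdgeKind.dotted →
      (∀ t, G.IsRealEdge t → G.Incident t v → t = a ∨ t = b) →
      ∃ t, t ≠ s ∧ G.IsRealEdge t ∧ G.kind t = EdgeKind.dotted ∧ G.Incident t v ∧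
        ∀ r, G.IsRealEdge r → G.Incident r v → r = s ∨ r = t := by
    intro a b hab ha hb hia hib hka hkb h
    rcases h s hr hi with rfl | rfl
    · exact ⟨b, hab.symm, hb, hkb, hib, h⟩
    · exact ⟨a, hab, ha, hka, hia, fun r h1 h2 => (h r h1 h2).symm⟩
  rcases (dotted_vertex hs hi).resolve_left hv with hw | hm
  · rcases white_edges hG hU hL ⟨s, hr, hi⟩ hw with
      ⟨a, b, hab, ha, hb, hia, hib, -, h, -⟩ | ⟨a, b, hab, ha, hb, hia, hib, h, -⟩
    · exact main a b hab ha hb (Or.inr hia) (Or.inr hib) (G.white_out a (by rwa [hia]))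
        (G.white_out b (by rwa [hib])) h
    · exfalso
      have : G.kind s = EdgeKind.bold := by
        rcases h s hr hi with rfl | rfl
        exacts [G.white_in _ (by rwa [hia]), G.white_in _ (by rwa [hib])]
      rw [hs] at this
      cases this
  · have hk : ∀ t, G.Incident t v → G.kind t = EdgeKind.dotted := fun t ht =>
      (G.monochrome_kind v hm t s ht hi).trans hs
    rcases monochrome_edges hG hm with
      ⟨a, b, hab, ha, hb, hia, hib, h, -⟩ | ⟨a, b, hab, ha, hb, hia, hib, h, -⟩
    · exact main a b hab ha hb (Or.inr hia) (Or.inr hib) (hk _ (Or.inr hia)) (hk _ (Or.inr hib)) h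
    · exact main a b hab ha hb (Or.inl hia) (Or.inl hib) (hk _ (Or.inl hia)) (hk _ (Or.inl hib)) h

/-- Two dotted real edges exclude a cross, and elsewhere there is no room for a third real edge. So
a dotted arc cannot be met again at an interior vertex. -/
theorem eq_or_eq_of_dotted [Finite S] (hG : G.IsDessin) (hU : G.IsUnramified)
    (hL : G.IsTypeILabelling L) {v : G.Vertex} {s t : S} (hst : s ≠ t)
    (hr : G.IsRealEdge s) (hs : G.kind s = EdgeKind.dotted) (hi : G.Incident s v)
    (hr' : G.IsRealEdge t) (ht : G.kind t = EdgeKind.dotted) (hi' : G.Incident t v) :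
    ∀ r, G.IsRealEdge r → G.Incident r v → r = s ∨ r = t := by
  have hv : G.vertexKind v ≠ VertexKind.cross := fun hv =>
    hst ((eq_of_incident_cross hG hU hv ht hi').2.2 s (eq_of_incident_cross hG hU hv hs hi).1)
  obtain ⟨t', -, -, -, -, h⟩ := exists_other_dotted hG hU hL hv hr hs hi
  obtain rfl := (h t hr' hi').resolve_left hst.symm
  exact h

/-- A dotted arc that does not start at a cross can be extended, unless it is contained in a
hyperbolic component. -/
theorem exists_longer_arc [Finite S] (hG : G.IsDessin) (hU : G.IsUnramified)
    (hL : G.IsTypeILabelling L) {n : ℕ} {p : ℕ → G.Vertex} {e : ℕ → S} (h : G.IsArcSeq n p e)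
    (hk : ∀ i ≤ n, G.kind (e i) = EdgeKind.dotted) (h0 : G.vertexKind (p 0) ≠ VertexKind.cross)
    {s : S} (hs : ∃ i ≤ n, e i = s) :
    (∃ A, G.IsHyperbolicComponent A ∧ s ∈ A) ∨
    ∃ p' e', G.IsArcSeq (n + 1) p' e' ∧ (∀ i ≤ n + 1, G.kind (e' i) = EdgeKind.dotted) ∧
      ∃ i ≤ n + 1, e' i = s := by
  obtain ⟨f, hf, hfr, hfk, hfi, -⟩ := exists_other_dotted hG hU hL h0 (h.real 0 (by omega))
    (hk 0 (by omega)) (h.incident_left (Nat.zero_le n))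
  obtain ⟨x, hx⟩ : ∃ x, (G.tail f = x ∧ G.head f = p 0) ∨ (G.head f = x ∧ G.tail f = p 0) := by
    rcases hfi with hfi | hfi
    exacts [⟨_, Or.inl ⟨rfl, hfi⟩⟩, ⟨_, Or.inr ⟨rfl, hfi⟩⟩]
  have hxi : G.Incident f x := by
    rcases hx with hx | hx
    exacts [Or.inr hx.1, Or.inl hx.1]
  have hx0 : x ≠ p 0 := by
    have := tail_ne_head_of_dotted hG hfr hfk
    rcases hx with ⟨h1, h2⟩ | ⟨h1, h2⟩ <;> rw [h1, h2] at this
    exacts [this, this.symm]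
  have hfv : ∀ v, G.Incident f v → v = x ∨ v = p 0 := by
    rintro v (rfl | rfl) <;> rcases hx with hx | hx <;> simp [hx]
  have hpass : ∀ i, i + 1 ≤ n → ∀ r, G.IsRealEdge r → G.Incident r (p (i + 1)) →
      r = e i ∨ r = e (i + 1) := fun i hi =>
    eq_or_eq_of_dotted hG hU hL (h.ne_succ hi) (h.real _ (by omega)) (hk _ (by omega))
      (h.incident_right (by omega)) (h.real _ hi) (hk _ hi) (h.incident_left hi)
  have hfe : ∀ i ≤ n, f ≠ e i := by
    rintro i hi rfl
    rcases h.eq_of_incident hi hfi with h1 | h1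
    · have := h.inj _ (by omega) _ (by omega) h1
      subst this
      exact hf rfl
    · have := h.inj _ (by omega) _ (by omega) h1
      omega
  by_cases hxp : ∀ i ≤ n + 1, p i ≠ x
  · refine Or.inr ⟨_, _, h.cons hfr hxp hx, ?_, ?_⟩
    · rintro (_ | i) hi
      exacts [hfk, hk i (by omega)]
    · obtain ⟨i, hi, rfl⟩ := hs
      exact ⟨i + 1, by omega, rfl⟩
  · left
    push Not at hxp
    obtain ⟨j, hj, rfl⟩ := hxp
    -- The new edge `f` leads back to the arc. Interior vertices are saturated and `f` is not a
    -- loop, so it ends at the other end of the arc.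
    obtain rfl : j = n + 1 := by
      by_contra hne
      rcases j with _ | j
      · exact hx0 rfl
      · rcases hpass j (by omega) f hfr hxi with h1 | h1
        · exact hfe _ (by omega) h1
        · exact hfe _ (by omega) h1
    -- The arc together with `f` is a closed circle: no other real edge meets its vertices, so it is
    -- the whole real component.
    have hclosed : ∀ t, Relation.ReflTransGen
        (fun a b => G.IsRealEdge a ∧ G.IsRealEdge b ∧ ∃ v, G.Incident a v ∧ G.Incident b v) s t →
        t = f ∨ ∃ i ≤ n, t = e i := by
      intro t ht
      induction ht with
      | refl =>
        obtain ⟨i, hi, rfl⟩ := hs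
        exact Or.inr ⟨i, hi, rfl⟩
      | tail _ hab ih =>
        obtain ⟨-, hb, v, hav, hbv⟩ := hab
        obtain ⟨j, hj, rfl⟩ : ∃ j ≤ n + 1, v = p j := by
          rcases ih with rfl | ⟨i, hi, rfl⟩
          · rcases hfv v hav with rfl | rfl
            exacts [⟨_, le_rfl, rfl⟩, ⟨0, by omega, rfl⟩]
          · rcases h.eq_of_incident hi hav with rfl | rfl
            exacts [⟨i, by omega, rfl⟩, ⟨i + 1, by omega, rfl⟩]
        rcases j with _ | j
        · rcases eq_or_eq_of_dotted hG hU hL hf hfr hfk hfi (h.real 0 (by omega))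
            (hk 0 (by omega)) (h.incident_left (by omega)) _ hb hbv with h1 | h1
          exacts [Or.inl h1, Or.inr ⟨0, by omega, h1⟩]
        · by_cases hjn : j = n
          · subst hjn
            rcases eq_or_eq_of_dotted hG hU hL (hfe j le_rfl) hfr hfk hxi (h.real j le_rfl)
              (hk j le_rfl) (h.incident_right le_rfl) _ hb hbv with h1 | h1
            exacts [Or.inl h1, Or.inr ⟨j, by omega, h1⟩]
          · rcases hpass j (by omega) _ hb hbv with h1 | h1
            exacts [Or.inr ⟨j, by omega, h1⟩, Or.inr ⟨j + 1, by omega, h1⟩]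
    refine ⟨{t | _}, ⟨⟨s, ?_, rfl⟩, fun t ht => ?_⟩, Relation.ReflTransGen.refl⟩
    · obtain ⟨i, hi, rfl⟩ := hs
      exact h.real i hi
    · rcases hclosed t ht with rfl | ⟨i, hi, rfl⟩
      exacts [hfk, hk i hi]

theorem exists_pillar_of_dotted [Finite S] (hG : G.IsDessin) (hU : G.IsUnramified)
    (hL : G.IsTypeILabelling L) {s : S} (hr : G.IsRealEdge s) (hs : G.kind s = EdgeKind.dotted) :
    ∃ A, G.IsPillar A ∧ s ∈ A := by
  by_contra hno
  have hhyp : ¬ ∃ A, G.IsHyperbolicComponent A ∧ s ∈ A := fun ⟨A, hA, hsA⟩ =>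
    hno ⟨A, Or.inl hA, hsA⟩
  -- Without a pillar through `s`, a dotted arc through `s` could be extended forever, giving more
  -- distinct vertices than there are.
  have hlong : ∀ n, ∃ p e, G.IsArcSeq n p e ∧ (∀ i ≤ n, G.kind (e i) = EdgeKind.dotted) ∧
      ∃ i ≤ n, e i = s := by
    intro n
    induction n with
    | zero =>
      refine ⟨fun i => if i = 0 then G.tail s else G.head s, fun _ => s, ⟨?_, fun _ _ => hr, ?_⟩,
        fun _ _ => hs, 0, le_rfl, rfl⟩
      · have := tail_ne_head_of_dotted hG hr hs
        intro i hi j hj hij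
        interval_cases i <;> interval_cases j <;> simp_all
      · intro i hi
        obtain rfl : i = 0 := by omega
        exact Or.inl ⟨rfl, rfl⟩
    | succ n ih =>
      obtain ⟨p, e, h, hk, hse⟩ := ih
      by_cases h0 : G.vertexKind (p 0) = VertexKind.cross
      · by_cases h1 : G.vertexKind (p (n + 1)) = VertexKind.cross
        · refine absurd ⟨{t | ∃ i ≤ n, e i = t}, Or.inr (Or.inl ⟨p 0, p (n + 1),
            ⟨isRealArc_iff.2 ⟨n, p, e, h, rfl, rfl, rfl⟩, ?_⟩, h0, h1⟩), hse⟩ hno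
          rintro t ⟨i, hi, rfl⟩
          exact hk i hi
        -- Extension works only at the initial end, so an arc starting at a cross is reversed first.
        · refine (exists_longer_arc hG hU hL h.reverse (fun i _ => hk _ (by omega)) h1
            ?_).resolve_left hhyp
          obtain ⟨i, hi, rfl⟩ := hse
          exact ⟨n - i, by omega, by simp only [Nat.sub_sub_self hi]⟩
      · exact (exists_longer_arc hG hU hL h hk h0 hse).resolve_left hhyp
  have hfin : Finite G.Vertex := Quotient.finite _
  obtain ⟨p, e, h, -, -⟩ := hlong (Nat.card G.Vertex)
  have := Nat.card_le_card_of_injective (fun i : Fin (Nat.card G.Vertex + 2) => p i)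
    (fun i j hij => Fin.ext (h.inj _ (by omega) _ (by omega) hij))
  rw [Nat.card_fin] at this
  omega

theorem mem_jump [Finite S] (hG : G.IsDessin) (hU : G.IsUnramified)
    (hL : G.IsTypeILabelling L) {a b : S} (hab : a ≠ b) (ha : G.IsRealEdge a)
    (hb : G.IsRealEdge b) (hw : G.vertexKind (G.head a) = VertexKind.white)
    (h : G.head b = G.head a) : G.IsJump {a, b} := by
  have hka := G.white_in a hw
  have hkb := G.white_in b (by rwa [h])
  have hu := (bold_ends hG hU hL hka).1
  have hv := (bold_ends hG hU hL hkb).1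
  have huv : G.tail a ≠ G.tail b := fun h' => hab (black_out_unique hG hU hL ha hb hu h')
  have huw : G.tail a ≠ G.head a := fun h' => by rw [h', hw] at hu; cases hu
  have hvw : G.tail b ≠ G.head a := fun h' => by rw [h', hw] at hv; cases hv
  refine ⟨G.tail a, G.tail b, G.head a, ⟨isRealArc_iff.2 ⟨1,
    fun i => if i = 0 then G.tail a else if i = 1 then G.head a else G.tail b,
    fun i => if i = 0 then a else b, ⟨?_, ?_, ?_⟩, rfl, rfl, ?_⟩, ?_⟩, ?_, hu, hv, hw, ?_⟩
  · intro i hi j hj hij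
    interval_cases i <;> interval_cases j <;> simp_all
  · intro i hi
    interval_cases i <;> simp_all
  · intro i hi
    interval_cases i <;> simp_all
  · ext t
    constructor
    · rintro (rfl | rfl)
      exacts [⟨0, by omega, rfl⟩, ⟨1, by omega, rfl⟩]
    · rintro ⟨i, hi, rfl⟩
      interval_cases i <;> simp
  · rintro t (rfl | rfl) <;> assumption
  · exact ⟨a, Or.inl rfl, Or.inl rfl⟩
  · rintro x ⟨t, rfl | rfl, rfl | rfl⟩ - <;> simp [h]

theorem IsJump.isPillar {A : Set S} (h : G.IsJump A) : G.IsPillar A := by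
  obtain ⟨u, v, w, h, -, hu, hv, -⟩ := h
  exact Or.inr (Or.inr ⟨u, v, h, hu, hv⟩)

theorem exists_jump_of_bold [Finite S] (hG : G.IsDessin) (hU : G.IsUnramified)
    (hL : G.IsTypeILabelling L) {s : S} (hr : G.IsRealEdge s) (hs : G.kind s = EdgeKind.bold) :
    ∃ A, G.IsJump A ∧ s ∈ A := by
  have hw := (bold_ends hG hU hL hs).2
  rcases white_edges hG hU hL (isRealVertex_head hr) hw with
    ⟨a, b, hab, ha, hb, hia, hib, -, h, -⟩ | ⟨a, b, hab, ha, hb, hia, hib, h, -⟩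
  · have : G.kind s = EdgeKind.dotted := by
      rcases h s hr (Or.inl rfl) with rfl | rfl
      exacts [G.white_out _ (by rwa [hia]), G.white_out _ (by rwa [hib])]
    rw [hs] at this
    cases this
  · exact ⟨{a, b}, mem_jump hG hU hL hab ha hb (by rwa [hia]) (hib.trans hia.symm),
      h s hr (Or.inl rfl)⟩

theorem exists_pillar [Finite S] (hG : G.IsDessin) (hU : G.IsUnramified)
    (hL : G.IsTypeILabelling L) {s : S} (hr : G.IsRealEdge s) (hs : G.kind s ≠ EdgeKind.solid) :
    ∃ A, G.IsPillar A ∧ s ∈ A := by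
  cases h : G.kind s
  case solid => exact absurd h hs
  case bold =>
    obtain ⟨A, hA, hsA⟩ := exists_jump_of_bold hG hU hL hr h
    exact ⟨A, hA.isPillar, hsA⟩
  case dotted => exact exists_pillar_of_dotted hG hU hL hr h

/-- Bold edges lead from black to white, so the first edge is run forwards and the second backwards.
The latter arrives at a black vertex, whose only real bold edge is thereby used up, so there are
exactly two edges. -/
theorem IsMaximalBoldSegment.isJump [Finite S] (hG : G.IsDessin) (hU : G.IsUnramified)
    (hL : G.IsTypeILabelling L) {A : Set S} (h : G.IsMaximalBoldSegment A) : G.IsJump A := by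
  obtain ⟨u, v, hseg, hu, hv⟩ := h
  have hseg' := hseg
  obtain ⟨harc, hk⟩ := hseg'
  obtain ⟨n, p, e, h, rfl, rfl, rfl⟩ := isRealArc_iff.1 harc
  have hb : ∀ i ≤ n, G.vertexKind (G.tail (e i)) = VertexKind.black ∧
      G.vertexKind (G.head (e i)) = VertexKind.white := fun i hi =>
    bold_ends hG hU hL (hk _ ⟨i, hi, rfl⟩)
  have h0 : G.tail (e 0) = p 0 ∧ G.head (e 0) = p 1 := by
    rcases h.ends 0 (by omega) with h | h
    · exact h
    · have := (hb 0 (by omega)).2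
      rw [h.1, hu] at this
      cases this
  have hw := (hb 0 (by omega)).2
  rw [h0.2] at hw
  have hn : 1 ≤ n := by
    by_contra hn
    obtain rfl : n = 0 := by omega
    rw [hw] at hv
    cases hv
  have h1 : G.head (e 1) = p 1 ∧ G.tail (e 1) = p 2 := by
    rcases h.ends 1 hn with h | h
    · have := (hb 1 hn).1
      rw [h.1, hw] at this
      cases this
    · exact h
  have h2 := (hb 1 hn).1
  obtain rfl : n = 1 := by
    by_contra hn1
    have hn2 : 2 ≤ n := by omega
    rcases h.ends 2 hn2 with h3 | h3
    · exact h.ne_succ hn2 (black_out_unique hG hU hL (h.real 1 hn) (h.real 2 hn2) h2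
        (h1.2.trans h3.1.symm))
    · have := (hb 2 hn2).2
      rw [h3.1, ← h1.2, h2] at this
      cases this
  refine ⟨p 0, p 2, p 1, hseg, ⟨e 0, ⟨0, by omega, rfl⟩, Or.inl h0.2⟩, hu, hv, hw, ?_⟩
  rintro x ⟨t, ⟨i, hi, rfl⟩, hx⟩ -
  have := h.eq_of_incident hi hx
  interval_cases i <;> simp at this <;> tauto

end TrichotomicGraph

/-! ### Types of pillars and of inner dotted edges -/

namespace TrichotomicGraph

open SurfaceGraph

variable {S R : Type*} {G : TrichotomicGraph S R} {L : R → RegionType}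

/-- At a cross the two edges coincide, and at a real white vertex all adjacent regions have one
label. At a monochrome vertex the inner dotted edge has equal labels on its sides, which belong to
the regions of the two real edges. -/
theorem label_eq_of_dotted [Finite S] (hG : G.IsDessin) (hU : G.IsUnramified)
    (hL : G.IsTypeILabelling L) {v : G.Vertex} {s t : S}
    (hr : G.IsRealEdge s) (hs : G.kind s = EdgeKind.dotted) (hi : G.Incident s v)
    (hr' : G.IsRealEdge t) (ht : G.kind t = EdgeKind.dotted) (hi' : G.Incident t v) :
    L (G.region s) = L (G.region t) := by
  rcases dotted_vertex hs hi with hv | hv | hv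
  · rw [(eq_of_incident_cross hG hU hv ht hi').2.2 s (eq_of_incident_cross hG hU hv hs hi).1]
  · rcases white_edges hG hU hL ⟨s, hr, hi⟩ hv with
      ⟨a, b, -, -, -, -, -, -, -, h⟩ | ⟨a, b, -, -, -, -, -, -, -, h⟩
    exacts [(h s hi).trans (h t hi').symm, (h s hi).trans (h t hi').symm]
  · have hk : ∀ r, G.Incident r v → G.kind r = EdgeKind.dotted := fun r h =>
      (G.monochrome_kind v hv r s h hi).trans hs
    rcases monochrome_edges hG hv with
      ⟨a, b, -, -, -, -, -, h, c, hc, hcv, h1, h2, -⟩ |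
      ⟨a, b, -, -, -, -, -, h, c, hc, hcv, h1, h2, -⟩
    · have := hL.inner_dotted c hc (hk c (Or.inl hcv))
      rw [h1, h2] at this
      rcases h s hr hi with rfl | rfl <;> rcases h t hr' hi' with rfl | rfl <;> simp [this]
    · have := hL.inner_dotted c hc (hk c (Or.inr hcv))
      rw [h1, h2] at this
      rcases h s hr hi with rfl | rfl <;> rcases h t hr' hi' with rfl | rfl <;> simp [this]

/-- Nonemptiness is what makes the type of a pillar unique. The dichotomy treats ovals, zigzags and
hyperbolic components together. -/
theorem isPillar_cases {A : Set S} (h : G.IsPillar A) :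
    (∃ s, s ∈ A) ∧ (∀ s ∈ A, G.IsRealEdge s) ∧
      ((∀ s ∈ A, G.kind s = EdgeKind.dotted) ∨ G.IsMaximalBoldSegment A) := by
  have harc : ∀ u v, G.IsRealArc A u v → (∃ s, s ∈ A) ∧ ∀ s ∈ A, G.IsRealEdge s := by
    rintro u v ⟨n, p, e, -, -, -, hr, -, rfl⟩
    refine ⟨⟨e 0, 0, rfl⟩, ?_⟩
    rintro _ ⟨i, rfl⟩
    exact hr i
  rcases h with ⟨⟨s, hs, rfl⟩, hk⟩ | ⟨u, v, ⟨ha, hk⟩, -⟩ | h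
  · refine ⟨⟨s, Relation.ReflTransGen.refl⟩, fun t ht => ?_, Or.inl hk⟩
    rcases Relation.ReflTransGen.cases_tail ht with rfl | ⟨_, -, h⟩
    exacts [hs, h.2.1]
  · exact ⟨(harc u v ha).1, (harc u v ha).2, Or.inl hk⟩
  · obtain ⟨u, v, ⟨ha, -⟩, -⟩ := id h
    exact ⟨(harc u v ha).1, (harc u v ha).2, Or.inr h⟩

theorem IsMaximalBoldSegment.kind {A : Set S} (h : G.IsMaximalBoldSegment A) :
    ∀ s ∈ A, G.kind s = EdgeKind.bold := by
  obtain ⟨u, v, ⟨-, h⟩, -⟩ := h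
  exact h

theorem IsPillar.kind_ne_solid {A : Set S} (h : G.IsPillar A) {s : S} (hs : s ∈ A) :
    G.kind s ≠ EdgeKind.solid := by
  rcases (isPillar_cases h).2.2 with hk | hb
  · rw [hk s hs]; simp
  · rw [hb.kind s hs]; simp

theorem IsPillar.label_eq [Finite S] (hG : G.IsDessin) (hU : G.IsUnramified)
    (hL : G.IsTypeILabelling L) {A : Set S} (h : G.IsPillar A) {s t : S} (hs : s ∈ A)
    (ht : t ∈ A) : L (G.region s) = L (G.region t) := by
  suffices ∃ l, ∀ s ∈ A, L (G.region s) = l by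
    obtain ⟨l, hl⟩ := this
    rw [hl s hs, hl t ht]
  rcases h with ⟨⟨s, hs, rfl⟩, hk⟩ | ⟨u, v, ⟨ha, hk⟩, -⟩ | h
  · refine ⟨L (G.region s), fun t ht => ?_⟩
    have := hk t ht
    change Relation.ReflTransGen _ s t at ht
    induction ht with
    | refl => rfl
    | tail hst hab ih =>
      obtain ⟨hra, hrb, v, hav, hbv⟩ := hab
      have hka := hk _ hst
      rw [← ih hka]
      exact label_eq_of_dotted hG hU hL hrb this hbv hra hka hav
  · obtain ⟨n, p, e, h, -, -, rfl⟩ := isRealArc_iff.1 ha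
    refine ⟨L (G.region (e 0)), ?_⟩
    rintro _ ⟨i, hi, rfl⟩
    induction i with
    | zero => rfl
    | succ i ih =>
      rw [← ih (by omega)]
      exact label_eq_of_dotted hG hU hL (h.real _ hi) (hk _ ⟨_, hi, rfl⟩) (h.incident_left hi)
        (h.real _ (by omega)) (hk _ ⟨_, by omega, rfl⟩) (h.incident_right (by omega))
  · exact ⟨RegionType.two, fun s hs => label_real_bold hG hU hL
      ((isPillar_cases (Or.inr (Or.inr h))).2.1 s hs) (h.kind s hs)⟩

theorem IsPillar.hasType [Finite S] (hG : G.IsDessin) (hU : G.IsUnramified)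
    (hL : G.IsTypeILabelling L) {A : Set S} (h : G.IsPillar A) {s : S} (hs : s ∈ A) :
    G.HasType L A (L (G.region s)) := fun _ ht => h.label_eq hG hU hL ht hs

theorem onPillarOfType [Finite S] (hG : G.IsDessin) (hU : G.IsUnramified)
    (hL : G.IsTypeILabelling L) {v : G.Vertex} {s : S} (hr : G.IsRealEdge s)
    (hs : G.kind s ≠ EdgeKind.solid) (hi : G.Incident s v) :
    G.OnPillarOfType L v (L (G.region s)) := by
  obtain ⟨A, hA, hsA⟩ := exists_pillar hG hU hL hr hs
  exact ⟨A, hA, hA.hasType hG hU hL hsA, s, hsA, hi⟩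

/-- An inner dotted edge has the type of any real edge adjacent to it. -/
theorem label_of_incident [Finite S] (hG : G.IsDessin) (hU : G.IsUnramified)
    (hL : G.IsTypeILabelling L) {v : G.Vertex} {s a : S} (hs : G.IsInnerDotted s)
    (hi : G.Incident s v) (hr : G.IsRealEdge a) (hi' : G.Incident a v) :
    L (G.region s) = L (G.region a) := by
  rcases dotted_vertex hs.2 hi with hv | hv | hv
  · exact absurd (eq_of_incident_cross hG hU hv hs.2 hi).2.1 hs.1
  · rcases white_edges hG hU hL ⟨a, hr, hi'⟩ hv with
      ⟨_, _, -, -, -, -, -, -, -, h⟩ | ⟨_, _, -, -, -, -, -, -, -, h⟩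
    exacts [(h s hi).trans (h a hi').symm, (h s hi).trans (h a hi').symm]
  · have hk : ∀ r, G.Incident r v → G.kind r = EdgeKind.dotted := fun r h =>
      (G.monochrome_kind v hv r s h hi).trans hs.2
    have main : ∀ x y c, (a = x ∨ a = y) → (s = c ∨ s = G.twin c) → ¬ G.IsRealEdge c →
        G.Incident c v → G.region c = G.region x → G.region (G.twin c) = G.region y →
        L (G.region s) = L (G.region a) := by
      intro x y c h1 h2 hc hcv h3 h4
      have := hL.inner_dotted c hc (hk c hcv)
      rw [h3, h4] at this
      rcases h1 with rfl | rfl <;> rcases h2 with rfl | rfl <;> simp [h3, h4, this]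
    rcases monochrome_edges hG hv with
      ⟨x, y, -, -, -, -, -, h, c, hc, hcv, h1, h2, h3⟩ |
      ⟨x, y, -, -, -, -, -, h, c, hc, hcv, h1, h2, h3⟩
    · exact main x y c (h a hr hi') (h3 s hs.1 hi) hc (Or.inl hcv) h1 h2
    · exact main x y c (h a hr hi') (h3 s hs.1 hi) hc (Or.inr hcv) h1 h2

theorem IsInnerDotted.ofType (hL : G.IsTypeILabelling L) {s : S} (hs : G.IsInnerDotted s) :
    G.IsInnerDottedOfType L s (L (G.region s)) :=
  ⟨hs, rfl, (hL.inner_dotted s hs.1 hs.2).symm⟩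

/-- A dotted monochrome vertex belongs to a pillar, and an inner dotted edge is attached to it. -/
theorem exists_edges_of_monochrome (hG : G.IsDessin) {s : S} {v : G.Vertex}
    (hs : G.kind s = EdgeKind.dotted) (hi : G.Incident s v)
    (hv : G.vertexKind v = VertexKind.monochrome) :
    (∃ a, G.IsRealEdge a ∧ G.kind a = EdgeKind.dotted ∧ G.Incident a v) ∧
      ∃ c, G.IsInnerDotted c ∧ G.Incident c v := by
  have hk : ∀ r, G.Incident r v → G.kind r = EdgeKind.dotted := fun r h =>
    (G.monochrome_kind v hv r s h hi).trans hs
  rcases monochrome_edges hG hv with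
    ⟨a, -, -, ha, -, hav, -, -, c, hc, hcv, -⟩ | ⟨a, -, -, ha, -, hav, -, -, c, hc, hcv, -⟩
  · exact ⟨⟨a, ha, hk a (Or.inr hav), Or.inr hav⟩, c, ⟨hc, hk c (Or.inl hcv)⟩, Or.inl hcv⟩
  · exact ⟨⟨a, ha, hk a (Or.inl hav), Or.inl hav⟩, c, ⟨hc, hk c (Or.inr hcv)⟩, Or.inr hcv⟩

theorem onPillar_of_monochrome [Finite S] (hG : G.IsDessin) (hU : G.IsUnramified)
    (hL : G.IsTypeILabelling L) {s : S} {v : G.Vertex} (hs : G.IsInnerDotted s)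
    (hi : G.Incident s v) (hv : G.vertexKind v = VertexKind.monochrome) :
    G.OnPillarOfType L v (L (G.region s)) := by
  obtain ⟨⟨a, ha, hka, hia⟩, -⟩ := exists_edges_of_monochrome hG hs.2 hi hv
  have hka' : G.kind a ≠ EdgeKind.solid := by rw [hka]; simp
  rw [label_of_incident hG hU hL hs hi ha hia]
  exact onPillarOfType hG hU hL ha hka' hia

/-- All edges at a cross are real, so an inner dotted edge can end only at a monochrome vertex,
whose real edges are dotted and hence lie on a pillar. -/
theorem IsInnerDotted.onPillar_head [Finite S] (hG : G.IsDessin) (hU : G.IsUnramified)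
    (hL : G.IsTypeILabelling L) {s : S} (hs : G.IsInnerDotted s) :
    G.OnPillarOfType L (G.head s) (L (G.region s)) := by
  rcases dotted_head hs.2 with h | h
  · exact absurd (cross_corner hG hU h).1 hs.1
  · exact onPillar_of_monochrome hG hU hL hs (Or.inl rfl) h

theorem label_of_inner_white [Finite S] (hG : G.IsDessin) (hU : G.IsUnramified)
    (hL : G.IsTypeILabelling L) {s : S} (hv : G.IsInnerWhite (G.tail s)) :
    L (G.region s) = RegionType.three := by
  obtain ⟨c, rfl⟩ := G.exists_next_eq s
  rw [tail_next] at hv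
  rw [G.region_next]
  exact label_inner_bold hG hU hL (fun h => hv.2 (isRealVertex_head h)) (G.white_in _ hv.1)

/-- A real white vertex with an inner dotted edge belongs to a jump. -/
theorem exists_jump_of_white [Finite S] (hG : G.IsDessin) (hU : G.IsUnramified)
    (hL : G.IsTypeILabelling L) {s : S} {v : G.Vertex} (hs : G.IsInnerDotted s)
    (hi : G.Incident s v) (hr : G.IsRealVertex v) (hv : G.vertexKind v = VertexKind.white) :
    L (G.region s) = RegionType.two ∧
      ∃ J : Set S, G.IsJump J ∧ G.HasType L J RegionType.two ∧ v ∈ G.verts J := by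
  rcases white_edges hG hU hL hr hv with
    ⟨a, b, -, ha, hb, -, -, h, -⟩ | ⟨a, b, hab, ha, hb, hia, hib, -, -, h⟩
  · exfalso
    rcases h s hs.2 hi with rfl | rfl
    exacts [hs.1 ha, hs.1 hb]
  · have hJ : G.IsJump {a, b} :=
      mem_jump hG hU hL hab ha hb (by rwa [hia]) (hib.trans hia.symm)
    refine ⟨h s hi, {a, b}, hJ, ?_, a, Or.inl rfl, Or.inl hia⟩
    rw [← h a (Or.inl hia)]
    exact hJ.isPillar.hasType hG hU hL (Or.inl rfl)

theorem IsInnerDotted.onPillar_tail [Finite S] (hG : G.IsDessin) (hU : G.IsUnramified)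
    (hL : G.IsTypeILabelling L) {s : S} (hs : G.IsInnerDotted s) :
    G.OnPillarOfType L (G.tail s) (L (G.region s)) ∨ G.IsInnerWhite (G.tail s) := by
  rcases dotted_tail hs.2 with h | h
  · by_cases hr : G.IsRealVertex (G.tail s)
    · obtain ⟨h2, J, hJ, hJt, hv⟩ := exists_jump_of_white hG hU hL hs (Or.inr rfl) hr h
      exact Or.inl ⟨J, hJ.isPillar, by rwa [h2], hv⟩
    · exact Or.inr ⟨h, hr⟩
  · exact Or.inl (onPillar_of_monochrome hG hU hL hs (Or.inr rfl) h)

/-- The white vertices of a dotted pillar are real and of type three. -/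
theorem label_of_white [Finite S] (hG : G.IsDessin) (hU : G.IsUnramified)
    (hL : G.IsTypeILabelling L) {s : S} {v : G.Vertex} (hr : G.IsRealEdge s)
    (hs : G.kind s = EdgeKind.dotted) (hi : G.Incident s v)
    (hv : G.vertexKind v = VertexKind.white) : L (G.region s) = RegionType.three := by
  rcases white_edges hG hU hL ⟨s, hr, hi⟩ hv with
    ⟨_, _, -, -, -, -, -, -, -, h⟩ | ⟨a, b, -, -, -, hia, hib, h, -, -⟩
  · exact h s hi
  · exfalso
    have : G.kind s = EdgeKind.bold := by
      rcases h s hr hi with rfl | rfl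
      exacts [G.white_in _ (by rwa [hia]), G.white_in _ (by rwa [hib])]
    rw [hs] at this
    cases this

theorem IsJump.hasType_two [Finite S] (hG : G.IsDessin) (hU : G.IsUnramified)
    (hL : G.IsTypeILabelling L) {A : Set S} (h : G.IsJump A) : G.HasType L A RegionType.two := by
  have hr := (isPillar_cases h.isPillar).2.1
  obtain ⟨u, v, w, ⟨-, hk⟩, -⟩ := h
  exact fun s hs => label_real_bold hG hU hL (hr s hs) (hk s hs)

theorem IsZigzag.hasType_three [Finite S] (hG : G.IsDessin) (hU : G.IsUnramified)
    (hL : G.IsTypeILabelling L) {A : Set S} (h : G.IsZigzag A) :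
    G.HasType L A RegionType.three := by
  obtain ⟨hm, hodd⟩ := h
  have hA : G.IsPillar A := Or.inr (Or.inl hm)
  -- An odd count is nonzero, so there is a white vertex, and it decides the type.
  obtain ⟨v, ⟨s, hs, hi⟩, hv⟩ := Set.nonempty_of_ncard_ne_zero hodd.pos.ne'
  obtain ⟨_, _, ⟨-, hk⟩, -⟩ := hm
  rw [← label_of_white hG hU hL ((isPillar_cases hA).2.1 s hs) (hk s hs) hi hv]
  exact hA.hasType hG hU hL hs

theorem isPillar_iff [Finite S] (hG : G.IsDessin) (hU : G.IsUnramified)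
    (hL : G.IsTypeILabelling L) (A : Set S) :
    G.IsPillar A ↔ G.IsOval A ∨ G.IsZigzag A ∨ G.IsJump A ∨ G.IsHyperbolicComponent A := by
  constructor
  · rintro (h | h | h)
    · exact Or.inr (Or.inr (Or.inr h))
    · rcases Nat.even_or_odd (G.whiteCount A) with h' | h'
      exacts [Or.inl ⟨h, h'⟩, Or.inr (Or.inl ⟨h, h'⟩)]
    · exact Or.inr (Or.inr (Or.inl (h.isJump hG hU hL)))
  · rintro (h | h | h | h)
    exacts [Or.inr (Or.inl h.1), Or.inr (Or.inl h.1), h.isPillar, Or.inl h]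

/-- On a dotted pillar of type two the tail of any edge is monochrome, since a white vertex would
force type three; its third edge is the required one. On a bold pillar the edge starts at a white
vertex. -/
theorem IsPillar.exists_inner_dotted [Finite S] (hG : G.IsDessin) (hU : G.IsUnramified)
    (hL : G.IsTypeILabelling L) {A : Set S} (h : G.IsPillar A)
    (ht : G.HasType L A RegionType.two) :
    ∃ s, G.IsInnerDottedOfType L s RegionType.two ∧ ∃ v ∈ G.verts A, G.Incident s v := by
  obtain ⟨⟨s, hs⟩, hr, hk | hb⟩ := isPillar_cases h
  · have hm := (dotted_tail (hk s hs)).resolve_left fun hw => by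
      have := label_of_white hG hU hL (hr s hs) (hk s hs) (Or.inr rfl) hw
      rw [ht s hs] at this
      cases this
    obtain ⟨-, c, hc, hi⟩ := exists_edges_of_monochrome hG (hk s hs) (Or.inr rfl) hm
    refine ⟨c, ?_, G.tail s, ⟨s, hs, Or.inr rfl⟩, hi⟩
    rw [← ht s hs, ← label_of_incident hG hU hL hc hi (hr s hs) (Or.inr rfl)]
    exact hc.ofType hL
  · have hks := hb.kind s hs
    have hw := (bold_ends hG hU hL hks).2
    rcases white_edges hG hU hL (isRealVertex_head (hr s hs)) hw with
      ⟨_, _, -, -, -, -, -, -, -, h⟩ | ⟨_, _, -, -, -, -, -, -, ⟨c, hc, hcv⟩, -⟩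
    · have := h s (Or.inl rfl)
      rw [ht s hs] at this
      cases this
    · have hc : G.IsInnerDotted c := ⟨hc, G.white_out c (by rwa [hcv])⟩
      refine ⟨c, ?_, G.head s, ⟨s, hs, Or.inl rfl⟩, Or.inr hcv⟩
      rw [← ht s hs,
        ← label_of_incident hG hU hL hc (Or.inr hcv) (hr s hs) (Or.inl rfl)]
      exact hc.ofType hL

theorem IsInnerWhite.exists_dotted_pair [Finite S] (hG : G.IsDessin) (hU : G.IsUnramified)
    (hL : G.IsTypeILabelling L) {v : G.Vertex} (hv : G.IsInnerWhite v) :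
    ∃ s s', s' ≠ s ∧ s' ≠ G.twin s ∧
      G.IsInnerDottedOfType L s RegionType.three ∧
      G.IsInnerDottedOfType L s' RegionType.three ∧
      G.tail s = v ∧ G.tail s' = v ∧
      G.OnPillarOfType L (G.head s) RegionType.three ∧
      G.OnPillarOfType L (G.head s') RegionType.three ∧
      ∀ a, G.kind a = EdgeKind.dotted → G.Incident a v →
        a = s ∨ a = G.twin s ∨ a = s' ∨ a = G.twin s' := by
  have h4 : G.cornerCount v = 4 := by
    rw [← cornerCount_of_inner hv.2, hG.white_fullValency v hv.1]
  obtain ⟨b, c, d, a, hbd, hcd, key, h1, h2⟩ := G.four_corners h4 hv.2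
  have hout : ∀ s, G.tail s = v → G.IsInnerDottedOfType L s RegionType.three ∧
      G.OnPillarOfType L (G.head s) RegionType.three := by
    intro s hs
    have hd : G.IsInnerDotted s :=
      ⟨fun h => hv.2 ⟨s, h, Or.inr hs⟩, G.white_out s (by rw [hs]; exact hv.1)⟩
    have hl : L (G.region s) = RegionType.three := label_of_inner_white hG hU hL (by rwa [hs])
    rw [← hl]
    exact ⟨hd.ofType hL, hd.onPillar_head hG hU hL⟩
  have hb : G.tail (G.next b) = v := (G.tail_next b).trans ((key b).2 (by simp))
  have hd : G.tail (G.next d) = v := (G.tail_next d).trans ((key d).2 (by simp))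
  refine ⟨G.next b, G.next d, G.next.injective.ne hbd.symm, ?_, (hout _ hb).1, (hout _ hd).1,
    hb, hd, (hout _ hb).2, (hout _ hd).2, ?_⟩
  · rw [h1]
    exact G.next.injective.ne hcd.symm
  -- Edges entering `v` are bold, so a dotted side leaves from one of the four corners, and these
  -- sides form two twin pairs.
  · rintro t ht (hi | hi)
    · rw [G.white_in t (by rw [hi]; exact hv.1)] at ht
      cases ht
    · obtain ⟨x, rfl⟩ := G.exists_next_eq t
      rw [tail_next, key] at hi
      rw [h1, h2]
      rcases hi with rfl | rfl | rfl | rfl <;> simp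

/-! ### The parity rule -/

theorem not_incident_white_of_solid {s : S} (hs : G.kind s = EdgeKind.solid) {v : G.Vertex}
    (hi : G.Incident s v) : G.vertexKind v ≠ VertexKind.white := by
  intro hv
  rcases hi with rfl | rfl
  · rcases solid_head hs with h | h <;> simp [h] at hv
  · rcases solid_tail hs with h | h <;> simp [h] at hv

/-- The real solid edge at the end of a pillar has the type of the pillar if it is directed away
from the pillar, and the other type if it is directed towards the pillar. -/
theorem label_at_pillar_end [Finite S] (hG : G.IsDessin) (hU : G.IsUnramified)
    (hL : G.IsTypeILabelling L) {v : G.Vertex} {a s : S} (ha : G.IsRealEdge a)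
    (hka : G.kind a ≠ EdgeKind.solid) (hia : G.Incident a v) (hs : G.IsRealEdge s)
    (hks : G.kind s = EdgeKind.solid) (his : G.Incident s v) :
    (G.tail s = v ∧ L (G.region s) = L (G.region a)) ∨
    (G.head s = v ∧ L (G.region s) ≠ L (G.region a)) := by
  cases hv : G.vertexKind v
  case monochrome =>
    exact absurd ((G.monochrome_kind v hv a s hia his).trans hks) hka
  case white => exact absurd hv (not_incident_white_of_solid hks his)
  case cross =>
    rcases his with rfl | rfl
    · rcases solid_head hks with h | h <;> simp [h] at hv
    · left
      rcases hia with h | h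
      · obtain ⟨x, rfl⟩ := G.exists_next_eq s
        rw [tail_next] at h hv
        rw [(cross_corner hG hU hv).2.2 a h, G.region_next]
        exact ⟨rfl, rfl⟩
      · exact absurd (G.cross_out a (by rwa [h])) hka
  case black =>
    rcases his with rfl | rfl
    · right
      rcases hia with h | h
      · exact absurd (G.black_in a (by rwa [h])) hka
      · refine ⟨rfl, ?_⟩
        rw [label_black_in hG hU hL hs hv,
          label_real_bold hG hU hL ha (G.black_out a (by rwa [h]))]
        simp
    · rcases solid_tail hks with h | h <;> simp [h] at hv

/-- At a monochrome vertex inside a solid segment both the orientation and the type change. -/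
theorem solid_step [Finite S] (hG : G.IsDessin) (hU : G.IsUnramified)
    (hL : G.IsTypeILabelling L) {v : G.Vertex} {a b : S} (hab : a ≠ b) (ha : G.IsRealEdge a)
    (hka : G.kind a = EdgeKind.solid) (hia : G.Incident a v) (hb : G.IsRealEdge b)
    (hkb : G.kind b = EdgeKind.solid) (hib : G.Incident b v) :
    L (G.region a) ≠ L (G.region b) ∧
      ((G.tail a = v ∧ G.tail b = v) ∨ (G.head a = v ∧ G.head b = v)) := by
  cases hv : G.vertexKind v
  case white => exact absurd hv (not_incident_white_of_solid hka hia)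
  case cross =>
    have key : ∀ t, G.kind t = EdgeKind.solid → G.Incident t v → G.tail t = v := by
      rintro t hk (rfl | h)
      · rcases solid_head hk with h | h <;> simp [h] at hv
      · exact h
    have h1 := key a hka hia
    have h2 := key b hkb hib
    obtain ⟨x, rfl⟩ := G.exists_next_eq a
    obtain ⟨y, rfl⟩ := G.exists_next_eq b
    rw [tail_next] at h1 h2
    subst h1
    rw [(cross_corner hG hU hv).2.2 y h2] at hab
    exact absurd rfl hab
  case black =>
    have key : ∀ t, G.kind t = EdgeKind.solid → G.Incident t v → G.head t = v := by
      rintro t hk (h | rfl)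
      · exact h
      · rcases solid_tail hk with h | h <;> simp [h] at hv
    exact absurd (black_in_unique hG hU hL ha hb (by rwa [key a hka hia])
      ((key a hka hia).trans (key b hkb hib).symm)) hab
  case monochrome =>
    have hk : ∀ r, G.Incident r v → G.kind r = EdgeKind.solid := fun r h =>
      (G.monochrome_kind v hv r a h hia).trans hka
    rcases monochrome_edges hG hv with
      ⟨x, y, -, -, -, hx, hy, h, c, hc, hcv, h1, h2, -⟩ |
      ⟨x, y, -, -, -, hx, hy, h, c, hc, hcv, h1, h2, -⟩
    -- The inner solid edge `c` separates the regions of the two real edges, so their labels differ.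
    · have hne := label_inner_solid hG hU hL hc (hk c (Or.inl hcv))
      rw [h1, h2] at hne
      rcases h a ha hia with rfl | rfl <;> rcases h b hb hib with rfl | rfl
      exacts [absurd rfl hab, ⟨hne.symm, Or.inl ⟨hx, hy⟩⟩, ⟨hne, Or.inl ⟨hy, hx⟩⟩, absurd rfl hab]
    · have hne := label_inner_solid hG hU hL hc (hk c (Or.inr hcv))
      rw [h1, h2] at hne
      rcases h a ha hia with rfl | rfl <;> rcases h b hb hib with rfl | rfl
      exacts [absurd rfl hab, ⟨hne.symm, Or.inr ⟨hx, hy⟩⟩, ⟨hne, Or.inr ⟨hy, hx⟩⟩, absurd rfl hab]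

/-- The parity rule. -/
theorem ConsecutivePillars.not_hasType [Finite S] (hG : G.IsDessin) (hU : G.IsUnramified)
    (hL : G.IsTypeILabelling L) {K A B : Set S} (h : G.ConsecutivePillars K A B) {t : RegionType}
    (hA : G.HasType L A t) : ¬ G.HasType L B t := by
  intro hB
  obtain ⟨hpA, hpB, -, -, C, u, v, hC, -, ⟨a, haA, hau⟩, ⟨b, hbB, hbv⟩, hno⟩ := h
  obtain ⟨n, p, e, h, rfl, rfl, rfl⟩ := isRealArc_iff.1 hC
  -- Every real edge that is not solid lies on some pillar, which the arc avoids.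
  have hk : ∀ i ≤ n, G.kind (e i) = EdgeKind.solid := by
    intro i hi
    by_contra hne
    obtain ⟨P, hP, hPe⟩ := exists_pillar hG hU hL (h.real i hi) hne
    exact hno _ ⟨i, hi, rfl⟩ P hP hPe
  have hpne : ∀ i ≤ n, p i ≠ p (i + 1) := fun i hi heq => by
    have := h.inj _ (by omega) _ (by omega) heq
    omega
  have hstart := label_at_pillar_end hG hU hL ((isPillar_cases hpA).2.1 a haA)
    (hpA.kind_ne_solid haA) hau (h.real 0 (by omega)) (hk 0 (by omega))
    (h.incident_left (by omega))
  have hend := label_at_pillar_end hG hU hL ((isPillar_cases hpB).2.1 b hbB)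
    (hpB.kind_ne_solid hbB) hbv (h.real n le_rfl) (hk n le_rfl) (h.incident_right le_rfl)
  rw [hA a haA] at hstart
  rw [hB b hbB] at hend
  have ht : t = RegionType.two ∨ t = RegionType.three := by
    rw [← hA a haA]
    exact label_two_or_three hG hU hL a
  -- Invariant along the arc: an edge has type `t` exactly when it is directed from `A` towards `B`.
  -- At the end next to `B`, `hend` demands the opposite correlation.
  have hinv : ∀ i ≤ n, (G.tail (e i) = p i ∧ G.head (e i) = p (i + 1) ∧ L (G.region (e i)) = t) ∨
      (G.head (e i) = p i ∧ G.tail (e i) = p (i + 1) ∧ L (G.region (e i)) ≠ t) := by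
    intro i hi
    have hne := hpne i hi
    have he := h.ends i hi
    induction i with
    | zero => grind
    | succ i ih =>
      have hne' := hpne i (by omega)
      have ih := ih (by omega) hne' (h.ends i (by omega))
      have hs := solid_step hG hU hL (h.ne_succ hi) (h.real i (by omega)) (hk i (by omega))
        (h.incident_right (by omega)) (h.real _ hi) (hk _ hi) (h.incident_left hi)
      have l1 := label_two_or_three hG hU hL (e i)
      have l2 := label_two_or_three hG hU hL (e (i + 1))
      grind
  have hn := hinv n le_rfl
  have hne := hpne n le_rfl
  grind

end TrichotomicGraph

theorem mainTheorem7 {S R : Type*} [Finite S] (G : TrichotomicGraph S R) (L : R → RegionType)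
    (hG : G.IsDessin) (hU : G.IsUnramified) (hL : G.IsTypeILabelling L) :
    -- the pillars are the ovals, zigzags, jumps and hyperbolic components
    (∀ A : Set S, G.IsPillar A ↔
      G.IsOval A ∨ G.IsZigzag A ∨ G.IsJump A ∨ G.IsHyperbolicComponent A) ∧
    -- each pillar has a well defined type, two or three; jumps have type two, zigzags type three
    (∀ A : Set S, G.IsPillar A →
      ∃ t, (t = RegionType.two ∨ t = RegionType.three) ∧ ∀ t', G.HasType L A t' ↔ t' = t) ∧
    (∀ A : Set S, G.IsJump A → G.HasType L A RegionType.two) ∧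
    (∀ A : Set S, G.IsZigzag A → G.HasType L A RegionType.three) ∧
    -- each inner dotted edge has type two or three, the type of any pillar it is attached to
    (∀ s, G.IsInnerDotted s →
      G.IsInnerDottedOfType L s RegionType.two ∨ G.IsInnerDottedOfType L s RegionType.three) ∧
    (∀ A : Set S, G.IsPillar A → ∀ t, G.HasType L A t →
      ∀ s, G.IsInnerDotted s → ∀ v ∈ G.verts A, G.Incident s v → G.IsInnerDottedOfType L s t) ∧
    -- pillars of type two are interconnected by inner dotted edges of type two
    (∀ s, G.IsInnerDottedOfType L s RegionType.two →
      G.OnPillarOfType L (G.tail s) RegionType.two ∧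
      G.OnPillarOfType L (G.head s) RegionType.two) ∧
    (∀ A : Set S, G.IsPillar A → G.HasType L A RegionType.two →
      ∃ s, G.IsInnerDottedOfType L s RegionType.two ∧ ∃ v ∈ G.verts A, G.Incident s v) ∧
    -- these edges (apart from end points at jumps) and the pillars of type two other than jumps
    -- are free of white vertices
    (∀ s, G.IsInnerDottedOfType L s RegionType.two →
      ∀ v, G.Incident s v → G.vertexKind v = VertexKind.white →
        ∃ J : Set S, G.IsJump J ∧ v ∈ G.verts J) ∧
    (∀ A : Set S, G.IsPillar A → G.HasType L A RegionType.two → ¬ G.IsJump A →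
      ∀ v ∈ G.verts A, G.vertexKind v ≠ VertexKind.white) ∧
    -- pillars of type three are interconnected by inner dotted edges of type three, or by pairs
    -- of such edges attached to an inner white vertex each
    (∀ s, G.IsInnerDottedOfType L s RegionType.three →
      G.OnPillarOfType L (G.head s) RegionType.three ∧
      (G.OnPillarOfType L (G.tail s) RegionType.three ∨ G.IsInnerWhite (G.tail s))) ∧
    (∀ v, G.IsInnerWhite v →
      ∃ s s', s' ≠ s ∧ s' ≠ G.twin s ∧
        G.IsInnerDottedOfType L s RegionType.three ∧
        G.IsInnerDottedOfType L s' RegionType.three ∧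
        G.tail s = v ∧ G.tail s' = v ∧
        G.OnPillarOfType L (G.head s) RegionType.three ∧
        G.OnPillarOfType L (G.head s') RegionType.three ∧
        ∀ a, G.kind a = EdgeKind.dotted → G.Incident a v →
          a = s ∨ a = G.twin s ∨ a = s' ∨ a = G.twin s') ∧
    -- the types of the pillars alternate along each real component
    (∀ K A B : Set S, G.IsRealComponent K → G.ConsecutivePillars K A B →
      ∀ t, G.HasType L A t → ¬ G.HasType L B t) := by
  refine ⟨TrichotomicGraph.isPillar_iff hG hU hL, fun A hA => ?_,
    fun A hA => hA.hasType_two hG hU hL, fun A hA => hA.hasType_three hG hU hL, fun s hs => ?_,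
    fun A hA t ht s hs v hv hi => ?_, fun s hs => ?_,
    fun A hA ht => hA.exists_inner_dotted hG hU hL ht, fun s hs v hi hv => ?_,
    fun A hA ht hJ v hv hw => ?_, fun s hs => ?_,
    fun v hv => hv.exists_dotted_pair hG hU hL, fun K A B _ h t hA => h.not_hasType hG hU hL hA⟩
  · obtain ⟨⟨s, hs⟩, -⟩ := TrichotomicGraph.isPillar_cases hA
    refine ⟨L (G.region s), TrichotomicGraph.label_two_or_three hG hU hL s, 
      fun t => ⟨fun h => ?_, ?_⟩⟩
    · exact (h s hs).symm
    · rintro rfl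
      exact hA.hasType hG hU hL hs
  · have := hs.ofType hL
    rcases TrichotomicGraph.label_two_or_three hG hU hL s with h | h <;> rw [h] at this
    exacts [Or.inl this, Or.inr this]
  · obtain ⟨a, haA, hia⟩ := hv
    rw [← ht a haA, ← TrichotomicGraph.label_of_incident hG hU hL hs hi
      ((TrichotomicGraph.isPillar_cases hA).2.1 a haA) hia]
    exact hs.ofType hL
  · obtain ⟨hd, hl, -⟩ := hs
    have h1 := hd.onPillar_tail hG hU hL
    have h2 := hd.onPillar_head hG hU hL
    rw [hl] at h1 h2
    -- An edge starting at an inner white vertex would be of type three.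
    refine ⟨h1.resolve_right fun hw => ?_, h2⟩
    rw [TrichotomicGraph.label_of_inner_white hG hU hL hw] at hl
    cases hl
  · obtain ⟨hd, hl, -⟩ := hs
    have hr : G.IsRealVertex v := by
      by_contra hr
      rcases hi with rfl | rfl
      · have := G.white_in s hv
        rw [hd.2] at this
        cases this
      · rw [TrichotomicGraph.label_of_inner_white hG hU hL ⟨hv, hr⟩] at hl
        cases hl
    obtain ⟨-, J, hJ, -, hvJ⟩ := TrichotomicGraph.exists_jump_of_white hG hU hL hd hi hr hv
    exact ⟨J, hJ, hvJ⟩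
  · obtain ⟨-, hr, hk | hb⟩ := TrichotomicGraph.isPillar_cases hA
    · obtain ⟨s, hs, hi⟩ := hv
      have := TrichotomicGraph.label_of_white hG hU hL (hr s hs) (hk s hs) hi hw
      rw [ht s hs] at this
      cases this
    · exact hJ (hb.isJump hG hU hL)
  · obtain ⟨hd, hl, -⟩ := hs
    rw [← hl]
    exact ⟨hd.onPillar_head hG hU hL, hd.onPillar_tail hG hU hL⟩
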